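/- Let $\alpha\in L^1(\mathbb R)$ be real-valued, $A=\int_{\mathbb R}\alpha(y)\,dy$, and write $(\alpha*v)(x)=\int_{\mathbb R}\alpha(y-x)v(y)\,dy$ (the usual convolution when $\alpha$ is even). Let $s>0$ and let $X=H^s(\mathbb R)\cap L^\infty(\mathbb R)$ be the space of real-valued functions with finite norm $\|u\|_{s,\infty}=\big(\int_{\mathbb R}(1+\xi^2)^s|\widehat u(\xi)|^2\,d\xi\big)^{1/2}+\|u\|_\infty$, where $\widehat u(\xi)=\int_{\mathbb R} e^{-2\pi i x\xi}u(x)\,dx$ (extended to $L^2$). For every $v\in X$ and almost every $x\in\mathbb R$, the function $y\mapsto\alpha(y-x)(v(y)-v(x))^3$ is integrable and $$\int_{\mathbb R}\alpha(y-x)\,(v(y)-v(x))^3\,dy=\big(\alpha*v^3-3v(\alpha*v^2)+3v^2(\alpha*v)-Av^3\big)(x),$$ so that for $w(\eta)=\eta^3$ the equation $u_{tt}=\int_{\mathbb R}\alpha(y-x)\,w(u(y,t)-u(x,t))\,dy$ becomes $$u_{tt}=\alpha*u^3-3u(\alpha*u^2)+3u^2(\alpha*u)-Au^3,\qquad u(x,0)=\varphi(x),\quad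 u_t(x,0)=\psi(x).\tag{P}$$ The Cauchy problem (P) is locally well posed in $X$ with solutions in $C^2([0,T],X)$: for all $\varphi,\psi\in X$ there is $T>0$ such that 1. there is exactly one $u\in C^2([0,T],X)$ that solves (P) on $[0,T]$ (time derivatives in the norm of $X$, one-sided at $0$ and $T$; equality in $x$ almost everywhere, for every $t\in[0,T]$); 2. there is $\delta>0$ such that for all $\varphi_1,\psi_1\in X$ with $\|\varphi_1-\varphi\|_{s,\infty}<\delta$ and $\|\psi_1-\psi\|_{s,\infty}<\delta$ the problem with data $\varphi_1,\psi_1$ has a solution in $C^2([0,T],X)$ on the same interval $[0,T]$, and any two solutions $u_1,u_2\in C^2([0,T],X)$ with data $(\varphi_1,\psi_1)$, $(\varphi_2,\psi_2)$ of this kind satisfy $$\|u_1(t)-u_2(t)\|_{s,\infty}\le 2\|\varphi_1-\varphi_2\|_{s,\infty}+2t\,\|\psi_1-\psi_2\|_{s,\infty}\qquad(0\le t\le T).$$ -/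

import Mathlib

open MeasureTheory Set Filter Topology
open scoped ENNReal FourierTransform

noncomputable section

namespace Peridynamic

/-- The Fourier transform `û ∈ L²(ℝ; ℂ)` of a real-valued `u ∈ L²(ℝ)`. -/
def fourierL2 : Lp ℝ 2 (volume : Measure ℝ) →ₗ[ℝ] Lp ℂ 2 (volume : Measure ℝ) :=
  ((Lp.fourierTransformₗᵢ ℝ ℂ).toLinearEquiv.toLinearMap.restrictScalars ℝ).comp
    (Complex.ofRealCLM.compLpL 2 volume).toLinearMap

/-- The weighted Fourier transform `ξ ↦ (1 + ξ²)^(s/2) û(ξ)`. -/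
def weightedFourier (s : ℝ) (u : Lp ℝ 2 (volume : Measure ℝ)) : ℝ → ℂ :=
  fun ξ ↦ ((1 + ξ ^ 2) ^ (s / 2) : ℝ) • (fourierL2 u : ℝ → ℂ) ξ

theorem weightedFourier_add (s : ℝ) (u v : Lp ℝ 2 (volume : Measure ℝ)) :
    weightedFourier s (u + v) =ᵐ[volume] weightedFourier s u + weightedFourier s v := by
  have h := Lp.coeFn_add (fourierL2 u) (fourierL2 v)
  filter_upwards [h] with ξ hξ
  simp only [weightedFourier, map_add, Pi.add_apply, hξ, smul_add]

theorem weightedFourier_smul (s c : ℝ) (u : Lp ℝ 2 (volume : Measure ℝ)) :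
    weightedFourier s (c • u) =ᵐ[volume] c • weightedFourier s u := by
  have h := Lp.coeFn_smul c (fourierL2 u)
  filter_upwards [h] with ξ hξ
  simp only [weightedFourier, map_smul, Pi.smul_apply, hξ]
  rw [smul_comm]

/-- The set `H^s(ℝ) ∩ L^∞(ℝ)` of real-valued functions (`s ≥ 0`, so that `H^s ⊆ L²`), as a
linear subspace of `L²(ℝ)`. -/
def hsLinfSubmodule (s : ℝ) : Submodule ℝ (Lp ℝ 2 (volume : Measure ℝ)) where
  carrier := {u | MemLp (weightedFourier s u) 2 volume ∧ MemLp (u : ℝ → ℝ) ∞ volume}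
  add_mem' {u v} hu hv :=
    ⟨(memLp_congr_ae (weightedFourier_add s u v)).2 (hu.1.add hv.1),
      (memLp_congr_ae (Lp.coeFn_add u v)).2 (hu.2.add hv.2)⟩
  zero_mem' := by
    have h0 : weightedFourier s 0 =ᵐ[volume] 0 := by
      simpa using weightedFourier_smul s 0 0
    exact ⟨(memLp_congr_ae h0).2 MemLp.zero, (memLp_congr_ae (Lp.coeFn_zero _ _ _)).2 MemLp.zero⟩
  smul_mem' c {u} hu :=
    ⟨(memLp_congr_ae (weightedFourier_smul s c u)).2 (hu.1.const_smul c),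
      (memLp_congr_ae (Lp.coeFn_smul c u)).2 (hu.2.const_smul c)⟩

/-- The space `H^s(ℝ) ∩ L^∞(ℝ)` of real-valued functions, `s ≥ 0`. It is a type of its own, since
it carries the norm `‖u‖_{H^s} + ‖u‖_∞` and not the one of `L²`. -/
def HsLinf (s : ℝ) : Type := ↥(hsLinfSubmodule s)

namespace HsLinf

variable {s : ℝ}

instance : AddCommGroup (HsLinf s) := inferInstanceAs (AddCommGroup ↥(hsLinfSubmodule s))

instance : Module ℝ (HsLinf s) := inferInstanceAs (Module ℝ ↥(hsLinfSubmodule s))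

/-- The underlying element of `L²(ℝ)`. -/
def toL2 (u : HsLinf s) : Lp ℝ 2 (volume : Measure ℝ) := u.1

/-- An element of `H^s ∩ L^∞` used as a function (defined up to null sets). -/
instance : CoeFun (HsLinf s) (fun _ ↦ ℝ → ℝ) := ⟨fun u ↦ (u.toL2 : ℝ → ℝ)⟩

/-- `‖u‖_{H^s} = (∫ (1 + ξ²)^s |û(ξ)|² dξ)^(1/2)`. -/
def sobolevNorm (u : HsLinf s) : ℝ :=
  Real.sqrt (∫ ξ, (1 + ξ ^ 2) ^ s * ‖(fourierL2 u.toL2 : ℝ → ℂ) ξ‖ ^ 2)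

/-- `‖u‖_∞`, the essential supremum of `|u|`. -/
def supNorm (u : HsLinf s) : ℝ := (eLpNorm (u : ℝ → ℝ) ∞ volume).toReal

/-- The norm `‖u‖_{s,∞} = ‖u‖_{H^s} + ‖u‖_∞`. -/
instance : Norm (HsLinf s) := ⟨fun u ↦ sobolevNorm u + supNorm u⟩

theorem norm_def (u : HsLinf s) : ‖u‖ = sobolevNorm u + supNorm u := rfl

theorem memLp_weightedFourier (u : HsLinf s) : MemLp (weightedFourier s u.toL2) 2 volume := u.2.1

theorem memLp_top (u : HsLinf s) : MemLp (u : ℝ → ℝ) ∞ volume := u.2.2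

theorem sobolevNorm_eq (u : HsLinf s) :
    sobolevNorm u = (eLpNorm (weightedFourier s u.toL2) 2 volume).toReal := by
  have h := (memLp_weightedFourier u).eLpNorm_eq_integral_rpow_norm two_ne_zero
    ENNReal.ofNat_ne_top
  rw [h, ENNReal.toReal_ofReal (by positivity), sobolevNorm, Real.sqrt_eq_rpow]
  simp only [ENNReal.toReal_ofNat, one_div]
  congr 1
  refine integral_congr_ae (ae_of_all _ fun ξ ↦ ?_)
  have h1 : (0 : ℝ) ≤ 1 + ξ ^ 2 := by positivity
  simp only [weightedFourier, norm_smul, Real.norm_eq_abs,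
    abs_of_nonneg (Real.rpow_nonneg h1 (s / 2)), Real.rpow_two, mul_pow]
  congr 1
  rw [← Real.rpow_two ((1 + ξ ^ 2) ^ (s / 2)), ← Real.rpow_mul h1, div_mul_cancel₀ s two_ne_zero]

theorem toReal_eLpNorm_add_le {E : Type*} [NormedAddCommGroup E] {p : ℝ≥0∞} (hp : 1 ≤ p)
    {f g h : ℝ → E} (hf : MemLp f p volume) (hg : MemLp g p volume) (hh : h =ᵐ[volume] f + g) :
    (eLpNorm h p volume).toReal ≤ (eLpNorm f p volume).toReal + (eLpNorm g p volume).toReal := by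
  rw [eLpNorm_congr_ae hh, ← ENNReal.toReal_add hf.eLpNorm_ne_top hg.eLpNorm_ne_top]
  exact ENNReal.toReal_mono (ENNReal.add_ne_top.2 ⟨hf.eLpNorm_ne_top, hg.eLpNorm_ne_top⟩)
    (eLpNorm_add_le hf.1 hg.1 hp)

theorem toReal_eLpNorm_smul {E : Type*} [NormedAddCommGroup E] [NormedSpace ℝ E] {p : ℝ≥0∞}
    (c : ℝ) {f h : ℝ → E} (hh : h =ᵐ[volume] c • f) :
    (eLpNorm h p volume).toReal = ‖c‖ * (eLpNorm f p volume).toReal := by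
  rw [eLpNorm_congr_ae hh, eLpNorm_const_smul]
  simp

theorem normCore (s : ℝ) : NormedSpace.Core ℝ (HsLinf s) where
  norm_nonneg u := add_nonneg (Real.sqrt_nonneg _) ENNReal.toReal_nonneg
  norm_smul c u := by
    rw [norm_def, norm_def, sobolevNorm_eq, sobolevNorm_eq, mul_add]
    exact congrArg₂ (· + ·) (toReal_eLpNorm_smul c (weightedFourier_smul s c u.toL2))
      (toReal_eLpNorm_smul c (Lp.coeFn_smul c u.toL2))
  norm_triangle u v := by
    rw [norm_def, norm_def, norm_def, sobolevNorm_eq, sobolevNorm_eq, sobolevNorm_eq]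
    have h1 := toReal_eLpNorm_add_le one_le_two (memLp_weightedFourier u)
      (memLp_weightedFourier v) (weightedFourier_add s u.toL2 v.toL2)
    have h2 := toReal_eLpNorm_add_le le_top (memLp_top u) (memLp_top v)
      (Lp.coeFn_add u.toL2 v.toL2)
    have h3 := add_le_add h1 h2
    rw [add_add_add_comm] at h3
    exact h3
  norm_eq_zero_iff u := by
    have hz : sobolevNorm (0 : HsLinf s) + supNorm (0 : HsLinf s) = 0 := by
      have h1 := toReal_eLpNorm_smul (p := 2) (0 : ℝ)
        (weightedFourier_smul s 0 (0 : Lp ℝ 2 (volume : Measure ℝ)))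
      have h2 := toReal_eLpNorm_smul (p := ∞) (0 : ℝ)
        (Lp.coeFn_smul (0 : ℝ) (0 : Lp ℝ 2 (volume : Measure ℝ)))
      rw [smul_zero, norm_zero, zero_mul] at h1 h2
      rw [sobolevNorm_eq]
      exact (congrArg₂ (· + ·) h1 h2).trans (add_zero 0)
    refine ⟨fun h ↦ ?_, fun h ↦ h ▸ hz⟩
    have hs : supNorm u = 0 := by
      have h0 : 0 ≤ sobolevNorm u := Real.sqrt_nonneg _
      have h1 : 0 ≤ supNorm u := ENNReal.toReal_nonneg
      rw [norm_def] at h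
      linarith
    have h2 : eLpNorm (u : ℝ → ℝ) ∞ volume = 0 :=
      ((ENNReal.toReal_eq_zero_iff _).1 hs).resolve_right (memLp_top u).eLpNorm_ne_top
    have h3 := (eLpNorm_eq_zero_iff (memLp_top u).1 ENNReal.top_ne_zero).1 h2
    exact Subtype.ext ((Lp.eq_zero_iff_ae_eq_zero).2 h3)

instance : NormedAddCommGroup (HsLinf s) := NormedAddCommGroup.ofCore (normCore s)

instance : NormedSpace ℝ (HsLinf s) := NormedSpace.ofCore (normCore s)

end HsLinf

/-- The convolution `(α ∗ v)(x) = ∫ α(y - x) v(y) dy`; for even `α` this is the usual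
convolution. -/
def conv (α v : ℝ → ℝ) (x : ℝ) : ℝ := ∫ y, α (y - x) * v y

/-- The right-hand side `α ∗ v³ - 3 v (α ∗ v²) + 3 v² (α ∗ v) - A v³`, `A = ∫ α`. -/
def cubicForce (α v : ℝ → ℝ) (x : ℝ) : ℝ :=
  conv α (fun y ↦ v y ^ 3) x - 3 * v x * conv α (fun y ↦ v y ^ 2) x
    + 3 * v x ^ 2 * conv α v x - (∫ y, α y) * v x ^ 3

/-- `u ∈ C²([0,T], H^s ∩ L^∞)` solves the Cauchy problem
`u_tt = α ∗ u³ - 3 u (α ∗ u²) + 3 u² (α ∗ u) - A u³`, `u(0) = φ`, `u_t(0) = ψ`.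
Only the values of `u` on `[0,T]` matter; time derivatives are taken in the norm of `H^s ∩ L^∞`,
one-sided at the end points. -/
structure IsSolution {s : ℝ} (α : ℝ → ℝ) (T : ℝ) (φ ψ : HsLinf s) (u : ℝ → HsLinf s) : Prop where
  contDiffOn : ContDiffOn ℝ 2 u (Icc 0 T)
  equation : ∀ t ∈ Icc 0 T,
    ⇑(iteratedDerivWithin 2 u (Icc 0 T) t) =ᵐ[volume] cubicForce α (u t)
  initial_value : u 0 = φ
  initial_velocity : derivWithin u (Icc 0 T) 0 = ψ

end Peridynamic

end

/-! The right-hand side of (P) is a polynomial in `v` built from two operations on the space X: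
pointwise multiplication and convolution with `α`. If both are bounded on X, the equation reads `u''
= F u` with `F : X → X` Lipschitz on bounded sets, and the theorem reduces to the Picard–Lindelöf
argument in a Banach space.

Convolution with an `L¹` function is bounded because on the Fourier side it is multiplication by a
function bounded by `‖α‖₁`, while the `L^∞` part is the trivial Young inequality (`exists_conv`).
Multiplication is the substantial point (`exists_eLpNorm_weightedFourier_mul_le`). For `0 < s < 1`
the homogeneous Sobolev seminorm is a constant times an integral of squared differences `u(x + h) -
u(x)` (`gagliardo_eq`), and the product rule for differences puts one factor in `L^∞`. For `s ≥ 1`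
the Fourier transform of an `H^s` function is integrable, the transform of a product is a
convolution, and the weight splits as `(1 + ξ²)^(s/2) ≲ (1 + t²)^(s/2) + (1 + (ξ - t)²)^(s/2)`, so
Young's inequality `L¹ ∗ L² ⊆ L²` concludes.

Picard iteration also needs X to be complete (`HsLinf.completeSpace`). Existence, uniqueness and the
factor 2 in the continuous dependence are then abstract (`wellPosed_secondOrder`): on a time
interval with `K T² ≤ 1` the Taylor bound for the difference of two solutions absorbs half of its
maximum. -/

namespace Peridynamic

/-! ### Second order differential equations in a Banach space -/

section SecondOrder

variable {E : Type*} [NormedAddCommGroup E]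

/-- The vector field `(u, p) ↦ (p, F u)`. -/
def systemField (F : E → E) (x : E × E) : E × E := (x.2, F x.1)

theorem lipschitzOnWith_systemField {K : NNReal} {s : Set E} (hF : LipschitzOnWith K F s) :
    LipschitzOnWith (max 1 K) (systemField F) (Prod.fst ⁻¹' s) :=
  (LipschitzWith.prod_snd.lipschitzOnWith).prodMk
    (by
    have h := hF.comp (g := F) (s := Prod.fst ⁻¹' s) (f := (Prod.fst : E × E → E))
      LipschitzWith.prod_fst.lipschitzOnWith (fun x hx ↦ hx)
    rwa [mul_one] at h)

variable [NormedSpace ℝ E]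

/-- `u ∈ C²([0,T], E)` solves `u'' = F u`, `u 0 = φ`, `u' 0 = ψ`. -/
structure SolvesSecondOrder (F : E → E) (T : ℝ) (φ ψ : E) (u : ℝ → E) : Prop where
  contDiffOn : ContDiffOn ℝ 2 u (Icc 0 T)
  equation : ∀ t ∈ Icc 0 T, iteratedDerivWithin 2 u (Icc 0 T) t = F (u t)
  initial_value : u 0 = φ
  initial_velocity : derivWithin u (Icc 0 T) 0 = ψ

/-- `(u, p)` solves the first order system `u' = p`, `p' = F u`, `(u, p) 0 = (φ, ψ)`. -/
structure SolvesSystem (F : E → E) (T : ℝ) (φ ψ : E) (u p : ℝ → E) : Prop where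
  deriv_fst : ∀ t ∈ Icc 0 T, HasDerivWithinAt u (p t) (Icc 0 T) t
  deriv_snd : ∀ t ∈ Icc 0 T, HasDerivWithinAt p (F (u t)) (Icc 0 T) t
  fst_zero : u 0 = φ
  snd_zero : p 0 = ψ

variable {F : E → E} {T : ℝ} {φ ψ φ₁ ψ₁ φ₂ ψ₂ : E} {u p u₁ p₁ u₂ p₂ : ℝ → E}

theorem SolvesSecondOrder.solvesSystem (hT : 0 < T) (h : SolvesSecondOrder F T φ ψ u) :
    SolvesSystem F T φ ψ u (derivWithin u (Icc 0 T)) := by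
  have hU := uniqueDiffOn_Icc hT
  have h2 : ContDiffOn ℝ (1 + 1) u (Icc 0 T) := by
    simpa only [one_add_one_eq_two] using h.contDiffOn
  have h1 := (contDiffOn_succ_iff_derivWithin hU).1 h2
  refine ⟨fun t ht ↦ (h1.1 t ht).hasDerivWithinAt, fun t ht ↦ ?_, h.initial_value,
    h.initial_velocity⟩
  have h3 := ((h1.2.2.differentiableOn one_ne_zero) t ht).hasDerivWithinAt
  rwa [← h.equation t ht, iteratedDerivWithin_succ,
    show iteratedDerivWithin 1 u (Icc 0 T) = derivWithin u (Icc 0 T) from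
      iteratedDerivWithin_one]

/-- Regularity bootstraps: `p' = F ∘ u` is continuous since `u` and `F` are, so `p` is `C¹` and `u`,
having derivative `p`, is `C²`. -/
theorem SolvesSystem.solvesSecondOrder (hT : 0 < T) (hF : Continuous F)
    (h : SolvesSystem F T φ ψ u p) : SolvesSecondOrder F T φ ψ u := by
  have hU := uniqueDiffOn_Icc hT
  have hd : ∀ t ∈ Icc 0 T, derivWithin u (Icc 0 T) t = p t :=
    fun t ht ↦ (h.deriv_fst t ht).derivWithin (hU t ht)
  have hp : ContDiffOn ℝ 1 p (Icc 0 T) := by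
    rw [show (1 : WithTop ℕ∞) = 0 + 1 by simp, contDiffOn_succ_iff_derivWithin hU]
    refine ⟨fun t ht ↦ (h.deriv_snd t ht).differentiableWithinAt, by simp, ?_⟩
    rw [contDiffOn_zero]
    refine ContinuousOn.congr (f := fun t ↦ F (u t)) ?_
      (fun t ht ↦ (h.deriv_snd t ht).derivWithin (hU t ht))
    exact hF.comp_continuousOn (HasDerivWithinAt.continuousOn h.deriv_fst)
  refine ⟨?_, fun t ht ↦ ?_, h.fst_zero, ?_⟩
  · rw [show (2 : WithTop ℕ∞) = 1 + 1 from one_add_one_eq_two.symm,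
      contDiffOn_succ_iff_derivWithin hU]
    exact ⟨fun t ht ↦ (h.deriv_fst t ht).differentiableWithinAt, by simp, hp.congr hd⟩
  · rw [iteratedDerivWithin_succ,
      show iteratedDerivWithin 1 u (Icc 0 T) = derivWithin u (Icc 0 T) from
        iteratedDerivWithin_one, derivWithin_congr hd (hd t ht)]
    exact (h.deriv_snd t ht).derivWithin (hU t ht)
  · rw [hd 0 (left_mem_Icc.2 hT.le), h.snd_zero]

theorem SolvesSystem.hasDerivWithinAt (h : SolvesSystem F T φ ψ u p) {t : ℝ} (ht : t ∈ Icc 0 T) :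
    HasDerivWithinAt (fun t ↦ (u t, p t)) (systemField F (u t, p t)) (Icc 0 T) t :=
  (h.deriv_fst t ht).prodMk (h.deriv_snd t ht)

/-- Uniqueness of solutions of the first order system. -/
theorem SolvesSystem.eqOn (hF : ∀ R : ℝ, ∃ K, LipschitzOnWith K F (Metric.closedBall 0 R))
    (h₁ : SolvesSystem F T φ ψ u₁ p₁) (h₂ : SolvesSystem F T φ ψ u₂ p₂) :
    EqOn u₁ u₂ (Icc 0 T) := by
  have c₁ := HasDerivWithinAt.continuousOn h₁.deriv_fst
  have c₂ := HasDerivWithinAt.continuousOn h₂.deriv_fst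
  -- Both orbits are compact, so one ball contains them and a single Lipschitz constant suffices.
  -- Only the first component needs a bound, because the system field is linear in the second.
  obtain ⟨R₁, hR₁⟩ := (isCompact_Icc.image_of_continuousOn c₁).isBounded.exists_norm_le
  obtain ⟨R₂, hR₂⟩ := (isCompact_Icc.image_of_continuousOn c₂).isBounded.exists_norm_le
  obtain ⟨K, hK⟩ := hF (max R₁ R₂)
  have key := ODE_solution_unique_of_mem_Icc_right (v := fun _ ↦ systemField F)
    (s := fun _ ↦ Prod.fst ⁻¹' Metric.closedBall 0 (max R₁ R₂)) (K := max 1 K)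
    (f := fun t ↦ (u₁ t, p₁ t)) (g := fun t ↦ (u₂ t, p₂ t)) (a := 0) (b := T)
    (fun t _ ↦ lipschitzOnWith_systemField hK)
    (HasDerivWithinAt.continuousOn fun t ht ↦ h₁.hasDerivWithinAt ht)
    (fun t ht ↦ (h₁.hasDerivWithinAt (Ico_subset_Icc_self ht)).mono_of_mem_nhdsWithin
      (Icc_mem_nhdsGE_of_mem ht))
    (fun t ht ↦ by
      simpa using .inl (hR₁ _ (mem_image_of_mem _ (Ico_subset_Icc_self ht))))
    (HasDerivWithinAt.continuousOn fun t ht ↦ h₂.hasDerivWithinAt ht)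
    (fun t ht ↦ (h₂.hasDerivWithinAt (Ico_subset_Icc_self ht)).mono_of_mem_nhdsWithin
      (Icc_mem_nhdsGE_of_mem ht))
    (fun t ht ↦ by
      simpa using .inr (hR₂ _ (mem_image_of_mem _ (Ico_subset_Icc_self ht))))
    (by simp [h₁.fst_zero, h₁.snd_zero, h₂.fst_zero, h₂.snd_zero])
  exact fun t ht ↦ congrArg Prod.fst (key ht)

/-- A bound on `u''` on `[0,t]` gives the Taylor bound on `u`. -/
theorem norm_le_of_norm_second_deriv_le {w q g : ℝ → E} {t M : ℝ}
    (hw : ∀ τ ∈ Icc 0 t, HasDerivWithinAt w (q τ) (Icc 0 t) τ)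
    (hq : ∀ τ ∈ Icc 0 t, HasDerivWithinAt q (g τ) (Icc 0 t) τ)
    (hg : ∀ τ ∈ Icc 0 t, ‖g τ‖ ≤ M) {τ : ℝ} (hτ : τ ∈ Icc 0 t) :
    ‖w τ‖ ≤ ‖w 0‖ + τ * ‖q 0‖ + M * (τ ^ 2 / 2) := by
  have hq' : ∀ τ ∈ Icc 0 t, ‖q τ‖ ≤ ‖q 0‖ + M * τ := fun τ hτ ↦
    image_norm_le_of_norm_deriv_right_le_deriv_boundary (f' := g) (B' := fun _ ↦ M)
      (B := fun τ ↦ ‖q 0‖ + M * τ)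
      (HasDerivWithinAt.continuousOn hq)
      (fun σ hσ ↦ (hq σ (Ico_subset_Icc_self hσ)).mono_of_mem_nhdsWithin
        (Icc_mem_nhdsGE_of_mem hσ)) (by simp)
      (fun σ ↦ by simpa using ((hasDerivAt_id σ).const_mul M).const_add ‖q 0‖)
      (fun σ hσ ↦ hg σ (Ico_subset_Icc_self hσ)) hτ
  refine image_norm_le_of_norm_deriv_right_le_deriv_boundary (f' := q)
    (B' := fun τ ↦ ‖q 0‖ + M * τ) (B := fun τ ↦ ‖w 0‖ + τ * ‖q 0‖ + M * (τ ^ 2 / 2))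
    (HasDerivWithinAt.continuousOn hw)
    (fun σ hσ ↦ (hw σ (Ico_subset_Icc_self hσ)).mono_of_mem_nhdsWithin
      (Icc_mem_nhdsGE_of_mem hσ)) (by simp) (fun σ ↦ ?_)
    (fun σ hσ ↦ hq' σ (Ico_subset_Icc_self hσ)) hτ
  have h1 := ((hasDerivAt_id σ).mul_const ‖q 0‖).const_add ‖w 0‖
  have h2 := ((hasDerivAt_pow 2 σ).div_const 2).const_mul M
  convert! h1.add h2 using 1
  simp

/-- Continuous dependence for solutions that stay in a set on which `F` is Lipschitz. -/
theorem SolvesSystem.norm_sub_le {K : NNReal} {s : Set E} (hK : LipschitzOnWith K F s)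
    (hKT : K * T ^ 2 ≤ 1) (h₁ : SolvesSystem F T φ₁ ψ₁ u₁ p₁) (h₂ : SolvesSystem F T φ₂ ψ₂ u₂ p₂)
    (hs₁ : MapsTo u₁ (Icc 0 T) s) (hs₂ : MapsTo u₂ (Icc 0 T) s) {t : ℝ} (ht : t ∈ Icc 0 T) :
    ‖u₁ t - u₂ t‖ ≤ 2 * ‖φ₁ - φ₂‖ + 2 * t * ‖ψ₁ - ψ₂‖ := by
  have hsub : Icc 0 t ⊆ Icc 0 T := Icc_subset_Icc_right ht.2
  have hw : ∀ τ ∈ Icc 0 t, HasDerivWithinAt (u₁ - u₂) ((p₁ - p₂) τ) (Icc 0 t) τ := fun τ hτ ↦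
    ((h₁.deriv_fst τ (hsub hτ)).sub (h₂.deriv_fst τ (hsub hτ))).mono hsub
  have hq : ∀ τ ∈ Icc 0 t, HasDerivWithinAt (p₁ - p₂) (F (u₁ τ) - F (u₂ τ)) (Icc 0 t) τ :=
    fun τ hτ ↦ ((h₁.deriv_snd τ (hsub hτ)).sub (h₂.deriv_snd τ (hsub hτ))).mono hsub
  -- The Taylor bound is applied at a maximum point `σ` of the difference: its quadratic term is
  -- then at most half of the maximum and moves to the left, which produces the factor 2.
  obtain ⟨σ, hσ, hmax⟩ := isCompact_Icc.exists_isMaxOn (nonempty_Icc.2 ht.1)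
    (HasDerivWithinAt.continuousOn hw).norm
  have hM : ∀ τ ∈ Icc 0 t, ‖u₁ τ - u₂ τ‖ ≤ ‖u₁ σ - u₂ σ‖ := fun τ hτ ↦ hmax hτ
  have hb := norm_le_of_norm_second_deriv_le hw hq (M := K * ‖u₁ σ - u₂ σ‖)
    (fun τ hτ ↦ (hK.norm_sub_le (hs₁ (hsub hτ)) (hs₂ (hsub hτ))).trans (by gcongr; exact hM τ hτ))
    hσ
  simp only [Pi.sub_apply, h₁.fst_zero, h₂.fst_zero, h₁.snd_zero, h₂.snd_zero] at hb
  have h3 : K * ‖u₁ σ - u₂ σ‖ * (σ ^ 2 / 2) ≤ ‖u₁ σ - u₂ σ‖ / 2 := by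
    have h4 : (K : ℝ) * σ ^ 2 ≤ 1 :=
      (mul_le_mul_of_nonneg_left (pow_le_pow_left₀ hσ.1 (hsub hσ).2 2) K.2).trans hKT
    nlinarith [norm_nonneg (u₁ σ - u₂ σ)]
  have h5 : σ * ‖ψ₁ - ψ₂‖ ≤ t * ‖ψ₁ - ψ₂‖ := by gcongr; exact hσ.2
  linarith [hM t ⟨ht.1, le_rfl⟩]

variable [CompleteSpace E]

/-- Picard–Lindelöf for the first order system, with the solution in the closed ball. -/
theorem exists_solvesSystem {a r L K : NNReal} (hT : 0 ≤ T)
    (hl : LipschitzOnWith K (systemField F) (Metric.closedBall (φ, ψ) a))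
    (hb : ∀ x ∈ Metric.closedBall (φ, ψ) a, ‖systemField F x‖ ≤ L)
    (hm : L * T ≤ a - r) (h₁ : (φ₁, ψ₁) ∈ Metric.closedBall (φ, ψ) r) :
    ∃ u p, SolvesSystem F T φ₁ ψ₁ u p ∧ MapsTo u (Icc 0 T) (Metric.closedBall φ a) := by
  have hf : IsPicardLindelof (fun _ ↦ systemField F) (tmin := 0) (tmax := T)
      ⟨0, left_mem_Icc.2 hT⟩ (φ, ψ) a r L K :=
    .of_time_independent hb hl (by simpa [hT] using hm)
  -- The fixed point `γ` of the Picard operator is used directly, since it carries the information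
  -- that the orbit stays in the closed ball.
  obtain ⟨γ, hγ⟩ := ODE.FunSpace.exists_isFixedPt_next hf h₁
  have h0 : γ.compProj 0 = (φ₁, ψ₁) := by
    have := γ.compProj_val (t := ⟨0, left_mem_Icc.2 hT⟩)
    rw [← hγ, ODE.FunSpace.next_apply₀] at this
    rw [← hγ]
    exact this
  have hd : ∀ t ∈ Icc 0 T,
      HasDerivWithinAt γ.compProj (systemField F (γ.compProj t)) (Icc 0 T) t := fun t ht ↦ by
    refine (ODE.hasDerivWithinAt_picard_Icc (left_mem_Icc.2 hT) hf.continuousOn_uncurry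
      γ.continuous_compProj.continuousOn (fun _ _ ↦ γ.compProj_mem_closedBall hf.mul_max_le)
      (φ₁, ψ₁) ht).congr_of_mem (fun t' ht' ↦ ?_) ht
    nth_rw 1 [← hγ]
    rw [ODE.FunSpace.compProj_of_mem ht', ODE.FunSpace.next_apply]
  refine ⟨fun t ↦ (γ.compProj t).1, fun t ↦ (γ.compProj t).2,
    ⟨fun t ht ↦ (hd t ht).fst, fun t ht ↦ (hd t ht).snd, congrArg Prod.fst h0,
      congrArg Prod.snd h0⟩, fun t ht ↦ ?_⟩
  have h2 := γ.compProj_mem_closedBall (t := t) hf.mul_max_le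
  rw [← closedBall_prod_same] at h2
  exact h2.1

/-- Local well-posedness of `u'' = F u` for `F` Lipschitz on bounded sets. -/
theorem wellPosed_secondOrder (hF : ∀ R : ℝ, ∃ K, LipschitzOnWith K F (Metric.closedBall 0 R))
    (φ ψ : E) : ∃ T : ℝ, 0 < T ∧
      (∃ u, SolvesSecondOrder F T φ ψ u ∧ ∀ v, SolvesSecondOrder F T φ ψ v → EqOn v u (Icc 0 T)) ∧
      ∃ δ : ℝ, 0 < δ ∧
        (∀ φ₁ ψ₁, ‖φ₁ - φ‖ < δ → ‖ψ₁ - ψ‖ < δ → ∃ u₁, SolvesSecondOrder F T φ₁ ψ₁ u₁) ∧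
        ∀ φ₁ ψ₁ φ₂ ψ₂, ‖φ₁ - φ‖ < δ → ‖ψ₁ - ψ‖ < δ → ‖φ₂ - φ‖ < δ → ‖ψ₂ - ψ‖ < δ →
          ∀ u₁ u₂, SolvesSecondOrder F T φ₁ ψ₁ u₁ → SolvesSecondOrder F T φ₂ ψ₂ u₂ →
            ∀ t ∈ Icc 0 T, ‖u₁ t - u₂ t‖ ≤ 2 * ‖φ₁ - φ₂‖ + 2 * t * ‖ψ₁ - ψ₂‖ := by
  have hFc : Continuous F := continuous_iff_continuousAt.2 fun x ↦ by
    obtain ⟨K, hK⟩ := hF (‖x‖ + 1)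
    refine hK.continuousOn.continuousAt (mem_of_superset (Metric.ball_mem_nhds x one_pos) ?_)
    refine Metric.ball_subset_closedBall.trans (Metric.closedBall_subset_closedBall' ?_)
    rw [dist_zero_right, add_comm]
  -- The ball of radius `2 + ‖φ‖` about 0 contains the ball of radius 2 about `φ`, in which all
  -- orbits will live.
  obtain ⟨K, hK⟩ := hF (2 + ‖φ‖)
  have hKφ : LipschitzOnWith K F (Metric.closedBall φ 2) :=
    hK.mono (Metric.closedBall_subset_closedBall' (by rw [dist_zero_right]))
  have hl : LipschitzOnWith (max 1 K) (systemField F) (Metric.closedBall (φ, ψ) (2 : NNReal)) :=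
    (lipschitzOnWith_systemField hKφ).mono fun x hx ↦ by
      rw [← closedBall_prod_same] at hx
      exact hx.1
  obtain ⟨L, hL⟩ : ∃ L : NNReal,
      ∀ x ∈ Metric.closedBall (φ, ψ) (2 : NNReal), ‖systemField F x‖ ≤ L := by
    refine ⟨‖systemField F (φ, ψ)‖₊ + max 1 K * 2, fun x hx ↦ ?_⟩
    have h1 := hl.norm_sub_le hx (Metric.mem_closedBall_self (by simp))
    have h2 : ‖x - (φ, ψ)‖ ≤ 2 := by simpa [dist_eq_norm] using hx
    have h3 := norm_le_norm_sub_add (systemField F x) (systemField F (φ, ψ))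
    have h4 : ((max 1 K : NNReal) : ℝ) * ‖x - (φ, ψ)‖ ≤ (max 1 K : NNReal) * 2 := by gcongr
    push_cast [-NNReal.coe_max] at *
    linarith
  -- `L T ≤ 1` keeps orbits starting within distance 1 of `(φ, ψ)` in the ball of radius 2; `K T² ≤
  -- 1` is what the absorption in `SolvesSystem.norm_sub_le` needs.
  obtain ⟨T, hT, hLT, hKT⟩ : ∃ T : ℝ, 0 < T ∧ L * T ≤ 1 ∧ K * T ^ 2 ≤ 1 := by
    have hpos : (0 : ℝ) < L + K + 1 := by positivity
    refine ⟨1 / (L + K + 1), by positivity, ?_, ?_⟩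
    · rw [mul_one_div, div_le_one hpos]
      linarith [K.2]
    · rw [one_div_pow, mul_one_div, div_le_one (by positivity)]
      nlinarith [K.2, L.2, mul_nonneg K.2 L.2]
  have hex : ∀ φ₁ ψ₁, ‖φ₁ - φ‖ < 1 → ‖ψ₁ - ψ‖ < 1 → ∃ u p, SolvesSystem F T φ₁ ψ₁ u p ∧
      MapsTo u (Icc 0 T) (Metric.closedBall φ 2) := fun φ₁ ψ₁ h₁ h₂ ↦
    exists_solvesSystem (a := 2) (r := 1) hT.le hl hL (by norm_num; exact hLT) (by
      rw [← closedBall_prod_same]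
      constructor <;> simpa [dist_eq_norm] using le_of_lt (by assumption))
  -- By uniqueness every solution coincides with the Picard solution and so stays in the ball, which
  -- makes the dependence estimate valid for arbitrary solutions.
  have hmap : ∀ φ₁ ψ₁, ‖φ₁ - φ‖ < 1 → ‖ψ₁ - ψ‖ < 1 → ∀ u p, SolvesSystem F T φ₁ ψ₁ u p →
      MapsTo u (Icc 0 T) (Metric.closedBall φ 2) := fun φ₁ ψ₁ h₁ h₂ u p hu ↦ by
    obtain ⟨v, q, hv, hvm⟩ := hex φ₁ ψ₁ h₁ h₂
    exact hvm.congr (hv.eqOn hF hu)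
  refine ⟨T, hT, ?_, 1, one_pos, fun φ₁ ψ₁ h₁ h₂ ↦ ?_, fun φ₁ ψ₁ φ₂ ψ₂ h₁ h₂ h₃ h₄ u₁ u₂ hu₁ hu₂ t
    ht ↦ ?_⟩
  · obtain ⟨u, p, hu, -⟩ := hex φ ψ (by simp) (by simp)
    exact ⟨u, hu.solvesSecondOrder hT hFc, fun v hv ↦ (hv.solvesSystem hT).eqOn hF hu⟩
  · obtain ⟨u, p, hu, -⟩ := hex φ₁ ψ₁ h₁ h₂
    exact ⟨u, hu.solvesSecondOrder hT hFc⟩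
  · have s₁ := hu₁.solvesSystem hT
    have s₂ := hu₂.solvesSystem hT
    exact s₁.norm_sub_le hKφ hKT s₂ (hmap _ _ h₁ h₂ _ _ s₁) (hmap _ _ h₃ h₄ _ _ s₂) ht

end SecondOrder

/-! ### Young's inequality for `L¹ ∗ L²` -/

section Young

theorem eLpNorm_two_sq {E : Type*} [NormedAddCommGroup E] (f : ℝ → E) :
    eLpNorm f 2 volume ^ 2 = ∫⁻ x, ‖f x‖ₑ ^ 2 := by
  have h := eLpNorm_nnreal_pow_eq_lintegral (f := f) (μ := volume) (p := 2) two_ne_zero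
  simpa using h

/-- Cauchy–Schwarz for the splitting `f g = f^(1/2) · (f g²)^(1/2)`, that is, with respect to the
measure `f μ`. -/
theorem lintegral_mul_sq_le {α : Type*} [MeasurableSpace α] {μ : Measure α} {f g : α → ℝ≥0∞}
    (hf : AEMeasurable f μ) (hg : AEMeasurable g μ) :
    (∫⁻ t, f t * g t ∂μ) ^ 2 ≤ (∫⁻ t, f t ∂μ) * ∫⁻ t, f t * g t ^ 2 ∂μ := by
  have h := ENNReal.lintegral_mul_norm_pow_le hf (hf.mul (hg.pow_const 2)) (p := 1 / 2)
    (q := 1 / 2) (by norm_num) (by norm_num) (by norm_num)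
  have h1 : ∀ t, f t ^ (1 / 2 : ℝ) * (f t * g t ^ 2) ^ (1 / 2 : ℝ) = f t * g t := fun t ↦ by
    rw [ENNReal.mul_rpow_of_nonneg _ _ (by norm_num), ← mul_assoc,
      ← ENNReal.rpow_add_of_nonneg _ _ (by norm_num) (by norm_num), ← ENNReal.rpow_natCast_mul]
    norm_num
  simp only [Pi.mul_apply, h1] at h
  refine (pow_le_pow_left₀ (zero_le) h 2).trans_eq ?_
  rw [mul_pow, ← ENNReal.rpow_mul_natCast, ← ENNReal.rpow_mul_natCast]
  norm_num

/-- Young's inequality `L¹ ∗ L² ⊆ L²`. -/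
theorem lintegral_conv_sq_le {f g : ℝ → ℝ≥0∞} (hf : AEMeasurable f) (hg : AEMeasurable g) :
    ∫⁻ x, (∫⁻ t, f t * g (x - t)) ^ 2 ≤ (∫⁻ t, f t) ^ 2 * ∫⁻ x, g x ^ 2 := by
  have hq : ∀ x : ℝ, AEMeasurable (fun t ↦ g (x - t)) := fun x ↦
    hg.comp_quasiMeasurePreserving (quasiMeasurePreserving_sub_left volume x)
  have hm : AEMeasurable (fun p : ℝ × ℝ ↦ f p.2 * g (p.1 - p.2) ^ 2) (volume.prod volume) :=
    (hf.comp_quasiMeasurePreserving Measure.quasiMeasurePreserving_snd).mul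
      ((hg.comp_quasiMeasurePreserving
        (quasiMeasurePreserving_sub volume volume)).pow_const 2)
  calc ∫⁻ x, (∫⁻ t, f t * g (x - t)) ^ 2
      ≤ ∫⁻ x, (∫⁻ t, f t) * ∫⁻ t, f t * g (x - t) ^ 2 :=
        lintegral_mono fun x ↦ lintegral_mul_sq_le hf (hq x)
    _ = (∫⁻ t, f t) * ∫⁻ x, ∫⁻ t, f t * g (x - t) ^ 2 :=
        lintegral_const_mul'' _ hm.lintegral_prod_right'
    _ = (∫⁻ t, f t) * ∫⁻ t, ∫⁻ x, f t * g (x - t) ^ 2 := by rw [lintegral_lintegral_swap hm]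
    _ = (∫⁻ t, f t) * ∫⁻ t, f t * ∫⁻ x, g x ^ 2 := by
        congr 1
        refine lintegral_congr fun t ↦ ?_
        have hgt : AEMeasurable (fun x ↦ g (x - t)) := hg.comp_quasiMeasurePreserving
          (measurePreserving_sub_right volume t).quasiMeasurePreserving
        rw [lintegral_const_mul'' _ (hgt.pow_const 2),
          lintegral_sub_right_eq_self (fun x ↦ g x ^ 2) t]
    _ = _ := by rw [lintegral_mul_const'' _ hf, sq, mul_assoc]

variable {𝕜 : Type*} [RCLike 𝕜] {f g : ℝ → 𝕜}

theorem aestronglyMeasurable_conv_integrand (hf : AEStronglyMeasurable f)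
    (hg : AEStronglyMeasurable g) :
    AEStronglyMeasurable (fun p : ℝ × ℝ ↦ f p.2 * g (p.1 - p.2)) (volume.prod volume) :=
  AEStronglyMeasurable.convolution_integrand (ContinuousLinearMap.mul 𝕜 𝕜) hf hg

theorem lintegral_enorm_conv_sq_le (hf : AEStronglyMeasurable f) (hg : AEStronglyMeasurable g) :
    ∫⁻ x, (∫⁻ t, ‖f t * g (x - t)‖ₑ) ^ 2 ≤ (eLpNorm f 1 volume * eLpNorm g 2 volume) ^ 2 := by
  rw [mul_pow, eLpNorm_one_eq_lintegral_enorm, eLpNorm_two_sq]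
  simp only [enorm_mul]
  exact lintegral_conv_sq_le hf.enorm hg.enorm

theorem ae_integrable_conv (hf : Integrable f) (hg : MemLp g 2) :
    ∀ᵐ x, Integrable fun t ↦ f t * g (x - t) := by
  have hm := aestronglyMeasurable_conv_integrand hf.1 hg.1
  have h := lintegral_enorm_conv_sq_le hf.1 hg.1
  have h2 : (eLpNorm f 1 volume * eLpNorm g 2 volume) ^ 2 ≠ ∞ :=
    ENNReal.pow_ne_top (ENNReal.mul_ne_top (memLp_one_iff_integrable.2 hf).2.ne hg.2.ne)
  filter_upwards [ae_lt_top' (hm.enorm.lintegral_prod_right'.pow_const 2) (h.trans_lt h2.lt_top).ne,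
    hm.prodMk_left] with x hx hx'
  exact ⟨hx', (ENNReal.pow_lt_top_iff.1 hx).resolve_right two_ne_zero⟩

theorem eLpNorm_conv_le (hf : AEStronglyMeasurable f) (hg : AEStronglyMeasurable g) :
    eLpNorm (fun x ↦ ∫ t, f t * g (x - t)) 2 volume ≤
      eLpNorm f 1 volume * eLpNorm g 2 volume := by
  rw [← ENNReal.pow_le_pow_left_iff two_ne_zero, eLpNorm_two_sq]
  refine le_trans (lintegral_mono fun x ↦ ?_) (lintegral_enorm_conv_sq_le hf hg)
  exact pow_le_pow_left₀ (zero_le) (enorm_integral_le_lintegral_enorm _) 2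

theorem memLp_conv (hf : Integrable f) (hg : MemLp g 2) :
    MemLp (fun x ↦ ∫ t, f t * g (x - t)) 2 :=
  ⟨(aestronglyMeasurable_conv_integrand hf.1 hg.1).integral_prod_right',
    (eLpNorm_conv_le hf.1 hg.1).trans_lt
      (ENNReal.mul_lt_top (memLp_one_iff_integrable.2 hf).2 hg.2)⟩

end Young

/-! ### Convolution and translation as Fourier multipliers on `L²` -/

section Fourier

/-- The Fourier transform on `L²(ℝ; ℂ)`. -/
noncomputable abbrev l2Fourier : Lp ℂ 2 (volume : Measure ℝ) ≃ₗᵢ[ℂ] Lp ℂ 2 (volume : Measure ℝ) :=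
  Lp.fourierTransformₗᵢ ℝ ℂ

theorem continuous_fourier_of_integrable {f : ℝ → ℂ} (hf : Integrable f) : Continuous (𝓕 f) :=
  VectorFourier.fourierIntegral_continuous
    Real.continuous_fourierChar (by exact continuous_inner) hf

theorem norm_fourier_le {f : ℝ → ℂ} (ξ : ℝ) : ‖𝓕 f ξ‖ ≤ ∫ x, ‖f x‖ :=
  VectorFourier.norm_fourierIntegral_le_integral_norm _ _ _ _ _

theorem memLp_top_fourier {f : ℝ → ℂ} (hf : Integrable f) : MemLp (𝓕 f) ∞ :=
  memLp_top_of_bound (continuous_fourier_of_integrable hf).aestronglyMeasurable _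
    (ae_of_all _ norm_fourier_le)

/-- On `L¹ ∩ L²` the Fourier transform of `L²` is given by the Fourier integral. -/
theorem l2Fourier_toLp_ae_eq {f : ℝ → ℂ} (hf : Integrable f) (hf2 : MemLp f 2) :
    ⇑(l2Fourier (hf2.toLp f)) =ᵐ[volume] 𝓕 f := by
  refine ae_eq_of_integral_contDiff_smul_eq ((Lp.memLp _).locallyIntegrable one_le_two)
    (continuous_fourier_of_integrable hf).locallyIntegrable fun φ hφ hs ↦ ?_
  have h1 : HasCompactSupport (fun x ↦ (φ x : ℂ)) := hs.comp_left Complex.ofReal_zero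
  have h2 : ContDiff ℝ (⊤ : ℕ∞) (fun x ↦ (φ x : ℂ)) := Complex.ofRealCLM.contDiff.comp hφ
  set Φ := h1.toSchwartzMap h2
  have hΦ : ∀ x, Φ x = (φ x : ℂ) := fun x ↦ rfl
  -- Tested against `Φ`, both transforms move onto the test function: `h3` does this for the `L²`
  -- transform through tempered distributions, `h4` for the Fourier integral through Fubini.
  have h3 := DFunLike.congr_fun (Lp.fourier_toTemperedDistribution_eq (hf2.toLp f)) Φ
  rw [TemperedDistribution.fourier_apply, Lp.toTemperedDistribution_apply,
    Lp.toTemperedDistribution_apply] at h3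
  have h4 := VectorFourier.integral_fourierIntegral_smul_eq_flip (e := Real.fourierChar)
    (μ := volume) (ν := volume) (L := innerₗ ℝ) (f := Φ) (g := f)
    Real.continuous_fourierChar continuous_inner Φ.integrable hf
  have h5 : ∫ x, (𝓕 Φ) x • (hf2.toLp f) x = ∫ x, (𝓕 Φ) x • f x := by
    refine integral_congr_ae ?_
    filter_upwards [hf2.coeFn_toLp] with x hx
    rw [hx]
  rw [h5] at h3
  simp only [hΦ, flip_innerₗ, Complex.real_smul.symm, smul_eq_mul] at h3 h4
  exact h3.symm.trans h4

/-- An operator identity `𝓕 (A g) = m · 𝓕 g` on `L²` has to be checked on Schwartz functions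
only. -/
theorem l2Fourier_ae_eq_mul_of_schwartz
    {A : Lp ℂ 2 (volume : Measure ℝ) → Lp ℂ 2 (volume : Measure ℝ)}
    (hA : Continuous A) {m : ℝ → ℂ} (hm : MemLp m ∞)
    (h : ∀ φ : SchwartzMap ℝ ℂ, ⇑(l2Fourier (A (φ.toLp 2))) =ᵐ[volume] fun ξ ↦
      m ξ * 𝓕 (φ : ℝ → ℂ) ξ)
    (g : Lp ℂ 2 (volume : Measure ℝ)) :
    ⇑(l2Fourier (A g)) =ᵐ[volume] fun ξ ↦ m ξ * l2Fourier g ξ := by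
  set M : Lp ℂ 2 (volume : Measure ℝ) → Lp ℂ 2 (volume : Measure ℝ) :=
    fun g ↦ (ContinuousLinearMap.mul ℂ ℂ).holderL volume ∞ 2 2 (hm.toLp m) g
  have hM : ∀ g, ⇑(M g) =ᵐ[volume] fun ξ ↦ m ξ * g ξ := fun g ↦ by
    filter_upwards [(ContinuousLinearMap.mul ℂ ℂ).coeFn_holder (r := 2) (hm.toLp m) g,
      hm.coeFn_toLp] with ξ h1 h2
    exact h1.trans (by rw [h2]; rfl)
  have hMc : Continuous M := ContinuousLinearMap.continuous _
  suffices l2Fourier (A g) = M (l2Fourier g) by rw [this]; exact hM _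
  refine DenseRange.induction_on (p := fun g ↦ l2Fourier (A g) = M (l2Fourier g))
    (SchwartzMap.denseRange_toLpCLM (p := 2) (F := ℂ) ENNReal.ofNat_ne_top) g ?_ fun φ ↦ ?_
  · exact isClosed_eq (l2Fourier.continuous.comp hA) (hMc.comp l2Fourier.continuous)
  · have h1 : l2Fourier (φ.toLp 2) = (𝓕 φ).toLp 2 := SchwartzMap.toLp_fourier_eq φ
    rw [SchwartzMap.toLpCLM_apply, h1]
    refine Lp.ext ((h φ).trans ((hM _).trans ?_).symm)
    filter_upwards [(𝓕 φ).coeFn_toLp 2 volume] with ξ hξ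
    rw [hξ, SchwartzMap.fourier_coe]

theorem conv_congr_ae {f g g' : ℝ → ℂ} (h : g =ᵐ[volume] g') (x : ℝ) :
    ∫ t, f t * g (x - t) = ∫ t, f t * g' (x - t) := by
  refine integral_congr_ae ?_
  filter_upwards [(quasiMeasurePreserving_sub_left volume x).ae h] with t ht
  rw [ht]

/-- `𝓕 (f ∗ g) = 𝓕 f · 𝓕 g` for `f ∈ L¹` and `g ∈ L²`. -/
theorem l2Fourier_conv {f : ℝ → ℂ} (hf : Integrable f) (g : Lp ℂ 2 (volume : Measure ℝ)) :
    ⇑(l2Fourier ((memLp_conv hf (Lp.memLp g)).toLp _)) =ᵐ[volume] fun ξ ↦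
      𝓕 f ξ * l2Fourier g ξ := by
  refine l2Fourier_ae_eq_mul_of_schwartz (A := fun g ↦ (memLp_conv hf (Lp.memLp g)).toLp _) ?_
    (memLp_top_fourier hf) (fun φ ↦ ?_) g
  · refine (LipschitzWith.of_dist_le_mul (K := (eLpNorm f 1 volume).toNNReal)
      fun g g' ↦ ?_).continuous
    have hn : eLpNorm f 1 volume ≠ ∞ := (memLp_one_iff_integrable.2 hf).2.ne
    rw [dist_eq_norm, dist_eq_norm, ← MemLp.toLp_sub, Lp.norm_toLp, Lp.norm_def,
      ENNReal.coe_toNNReal_eq_toReal, ← ENNReal.toReal_mul]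
    refine ENNReal.toReal_mono (ENNReal.mul_ne_top hn (Lp.eLpNorm_ne_top _)) ?_
    refine le_trans (eLpNorm_congr_ae ?_).le (eLpNorm_conv_le hf.1 (Lp.memLp (g - g')).1)
    filter_upwards [ae_integrable_conv hf (Lp.memLp g), ae_integrable_conv hf (Lp.memLp g')]
      with x h1 h2
    rw [conv_congr_ae (Lp.coeFn_sub g g'), Pi.sub_apply, ← integral_sub h1 h2]
    simp only [Pi.sub_apply, mul_sub]
  · have hφ : MemLp (fun x ↦ ∫ t, f t * φ (x - t)) 2 := memLp_conv hf (φ.memLp 2)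
    have hφ1 : Integrable (fun x ↦ ∫ t, f t * φ (x - t)) :=
      hf.integrable_convolution (ContinuousLinearMap.mul ℂ ℂ) φ.integrable
    have h1 : (memLp_conv hf (Lp.memLp (φ.toLp 2))).toLp _ = hφ.toLp _ :=
      MemLp.toLp_congr _ _ (ae_of_all _ fun x ↦ conv_congr_ae (φ.coeFn_toLp 2 volume) x)
    simp only [h1]
    refine (l2Fourier_toLp_ae_eq hφ1 hφ).trans (ae_of_all _ fun ξ ↦ ?_)
    exact Real.fourier_mul_convolution_eq hf φ.integrable ξ

theorem continuous_coe_fourierChar : Continuous fun y : ℝ ↦ ((Real.fourierChar y : Circle) : ℂ) :=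
  (show Continuous ((↑) : Circle → ℂ) from continuous_subtype_val).comp Real.continuous_fourierChar

/-- `𝓕 (g (· + h)) = e^{2πihξ} 𝓕 g` for `g ∈ L²`. -/
theorem l2Fourier_translate (h : ℝ) (g : Lp ℂ 2 (volume : Measure ℝ)) :
    ⇑(l2Fourier (Lp.compMeasurePreserving (· + h) (measurePreserving_add_right volume h) g))
      =ᵐ[volume] fun ξ ↦ ((Real.fourierChar (h * ξ) : Circle) : ℂ) * l2Fourier g ξ := by
  refine l2Fourier_ae_eq_mul_of_schwartz (A := fun g ↦ Lp.compMeasurePreserving (· + h)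
    (measurePreserving_add_right volume h) g) (Lp.isometry_compMeasurePreserving _).continuous
    (memLp_top_of_bound ?_ 1 (ae_of_all _ fun ξ ↦ (Circle.norm_coe _).le)) (fun φ ↦ ?_) g
  · have : Continuous fun ξ : ℝ ↦ ((Real.fourierChar (h * ξ) : Circle) : ℂ) :=
      continuous_coe_fourierChar.comp (by fun_prop)
    exact this.aestronglyMeasurable
  · have hφ : MemLp (fun x ↦ φ (x + h)) 2 :=
      (φ.memLp 2).comp_measurePreserving (measurePreserving_add_right volume h)
    have h1 : Lp.compMeasurePreserving (· + h) (measurePreserving_add_right volume h) (φ.toLp 2)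
        = hφ.toLp _ := by
      refine Lp.ext ((Lp.coeFn_compMeasurePreserving _ _).trans (EventuallyEq.trans ?_
        hφ.coeFn_toLp.symm))
      exact (measurePreserving_add_right volume h).quasiMeasurePreserving.ae_eq_comp
        (φ.coeFn_toLp 2 volume)
    rw [h1]
    refine (l2Fourier_toLp_ae_eq (φ.integrable.comp_add_right h) hφ).trans
      (ae_of_all _ fun ξ ↦ ?_)
    have h2 := congrFun (VectorFourier.fourierIntegral_comp_add_right Real.fourierChar volume
      (innerₗ ℝ) (φ : ℝ → ℂ) h) ξ
    refine h2.trans ?_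
    rw [Circle.smul_def, smul_eq_mul, innerₗ_apply_apply,
      show inner ℝ h ξ = h * ξ by simp [mul_comm]]
    rfl

end Fourier
theorem ennreal_add_sq_le (a b : ℝ≥0∞) : (a + b) ^ 2 ≤ 2 * a ^ 2 + 2 * b ^ 2 := by
  have h := ENNReal.rpow_add_le_mul_rpow_add_rpow a b (p := 2) one_le_two
  norm_num [mul_add] at h
  exact h

/-! ### Plancherel and the weighted Fourier norm in `[0, ∞]` -/

section Basic

/-- The complexification of a real-valued `L²` function. -/
noncomputable abbrev complexify (u : Lp ℝ 2 (volume : Measure ℝ)) : Lp ℂ 2 (volume : Measure ℝ) :=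
  Complex.ofRealCLM.compLpL 2 volume u

variable (u : Lp ℝ 2 (volume : Measure ℝ)) (s : ℝ)

theorem coeFn_complexify : ⇑(complexify u) =ᵐ[volume] fun x ↦ (u x : ℂ) :=
  Complex.ofRealCLM.coeFn_compLpL u

theorem fourierL2_apply : fourierL2 u = l2Fourier (complexify u) := rfl

theorem eLpNorm_complexify : eLpNorm (complexify u) 2 volume = eLpNorm u 2 volume := by
  rw [eLpNorm_congr_ae (coeFn_complexify u)]
  exact eLpNorm_congr_norm_ae (ae_of_all _ fun x ↦ by simp)

theorem eLpNorm_l2Fourier (g : Lp ℂ 2 (volume : Measure ℝ)) :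
    eLpNorm (l2Fourier g) 2 volume = eLpNorm g 2 volume := by
  rw [← Lp.enorm_def, ← Lp.enorm_def]
  exact (enorm_eq_iff_norm_eq).2 (l2Fourier.norm_map g)

theorem eLpNorm_fourierL2 : eLpNorm (fourierL2 u) 2 volume = eLpNorm u 2 volume := by
  rw [fourierL2_apply, eLpNorm_l2Fourier, eLpNorm_complexify]

theorem continuous_one_add_sq_rpow : Continuous fun ξ : ℝ ↦ (1 + ξ ^ 2) ^ s :=
  (by fun_prop : Continuous fun ξ : ℝ ↦ 1 + ξ ^ 2).rpow_const fun ξ ↦ .inl (by positivity)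

theorem aestronglyMeasurable_weightedFourier :
    AEStronglyMeasurable (weightedFourier s u) volume :=
  (continuous_one_add_sq_rpow (s / 2)).aestronglyMeasurable.smul (Lp.memLp (fourierL2 u)).1

theorem enorm_weightedFourier (ξ : ℝ) :
    ‖weightedFourier s u ξ‖ₑ = ENNReal.ofReal ((1 + ξ ^ 2) ^ (s / 2)) * ‖fourierL2 u ξ‖ₑ := by
  rw [weightedFourier, enorm_smul, Real.enorm_of_nonneg (by positivity)]

theorem ofReal_weight_sq (ξ : ℝ) :
    ENNReal.ofReal ((1 + ξ ^ 2) ^ (s / 2)) ^ 2 = ENNReal.ofReal ((1 + ξ ^ 2) ^ s) := by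
  rw [← ENNReal.ofReal_pow (by positivity), ← Real.rpow_mul_natCast (by positivity)]
  norm_num

theorem eLpNorm_weightedFourier_sq :
    eLpNorm (weightedFourier s u) 2 volume ^ 2 =
      ∫⁻ ξ, ENNReal.ofReal ((1 + ξ ^ 2) ^ s) * ‖fourierL2 u ξ‖ₑ ^ 2 := by
  rw [eLpNorm_two_sq]
  simp only [enorm_weightedFourier, mul_pow, ofReal_weight_sq]

variable {s}

theorem eLpNorm_le_eLpNorm_weightedFourier (hs : 0 ≤ s) :
    eLpNorm u 2 volume ≤ eLpNorm (weightedFourier s u) 2 volume := by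
  rw [← eLpNorm_fourierL2]
  refine eLpNorm_mono fun ξ ↦ ?_
  rw [weightedFourier, norm_smul, Real.norm_of_nonneg (by positivity)]
  exact le_mul_of_one_le_left (norm_nonneg _)
    (Real.one_le_rpow (by nlinarith [sq_nonneg ξ]) (by positivity))

end Basic

/-! ### Products for `0 < s < 1`: the Gagliardo seminorm -/

section Gagliardo

theorem norm_fourierChar_sub_one_le (y : ℝ) :
    ‖((Real.fourierChar y : Circle) : ℂ) - 1‖ ≤ 2 * Real.pi * |y| := by
  rw [Real.fourierChar_apply, mul_comm]
  refine Real.norm_exp_I_mul_ofReal_sub_one_le.trans_eq ?_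
  rw [Real.norm_eq_abs, abs_mul, abs_of_pos (by positivity : 0 < 2 * Real.pi)]

theorem norm_fourierChar_sub_one_le_two (y : ℝ) :
    ‖((Real.fourierChar y : Circle) : ℂ) - 1‖ ≤ 2 := by
  refine (norm_sub_le _ _).trans ?_
  rw [Circle.norm_coe, norm_one]
  norm_num

theorem fourierChar_ne_one {y : ℝ} (h0 : 0 < y) (h1 : y < 1) :
    ((Real.fourierChar y : Circle) : ℂ) ≠ 1 := by
  rw [Real.fourierChar_apply, Ne, Complex.exp_eq_one_iff]
  rintro ⟨n, hn⟩
  have h2 : (y : ℂ) = n := by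
    have : (2 * Real.pi * Complex.I : ℂ) ≠ 0 := Complex.two_pi_I_ne_zero
    apply mul_right_cancel₀ this
    push_cast at hn
    linear_combination hn
  have h3 : y = n := by exact_mod_cast h2
  rw [h3] at h0 h1
  have h4 : 0 < n := by exact_mod_cast h0
  have h5 : n < 1 := by exact_mod_cast h1
  omega

/-- `|e^{2πiy} - 1|²`. -/
noncomputable def charDiffSq (y : ℝ) : ℝ≥0∞ := ‖((Real.fourierChar y : Circle) : ℂ) - 1‖ₑ ^ 2

theorem measurable_charDiffSq : Measurable charDiffSq :=
  ((continuous_coe_fourierChar.sub continuous_const).measurable.enorm).pow_const 2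

theorem charDiffSq_neg (y : ℝ) : charDiffSq (-y) = charDiffSq y := by
  unfold charDiffSq
  congr 1
  rw [enorm_eq_iff_norm_eq, AddChar.map_neg_eq_inv, Circle.coe_inv_eq_conj, ← RCLike.norm_conj]
  simp

/-- The kernel `h ^ (-(1 + 2 s))`. -/
noncomputable def gagliardoKernel (s h : ℝ) : ℝ≥0∞ := ENNReal.ofReal (h ^ (-(1 + 2 * s)))

theorem measurable_gagliardoKernel (s : ℝ) : Measurable (gagliardoKernel s) :=
  (measurable_id.pow_const _).ennreal_ofReal

/-- The constant `∫₀^∞ |e^{2πih} - 1|² h^(-1-2s) dh`. -/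
noncomputable def gagliardoConst (s : ℝ) : ℝ≥0∞ :=
  ∫⁻ h in Ioi 0, gagliardoKernel s h * charDiffSq h

theorem gagliardoConst_ne_zero (s : ℝ) : gagliardoConst s ≠ 0 := by
  intro h
  have hm : Measurable fun h ↦ gagliardoKernel s h * charDiffSq h :=
    (measurable_gagliardoKernel s).mul measurable_charDiffSq
  rw [gagliardoConst, lintegral_eq_zero_iff hm] at h
  -- On `(0, 1)` the kernel is positive and `e^{2πiy} ≠ 1`, so a vanishing integral would make this
  -- interval a null set.
  have h1 : ∀ᵐ y ∂(volume.restrict (Ioo (0 : ℝ) 1)), False := by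
    filter_upwards [ae_restrict_of_ae_restrict_of_subset Ioo_subset_Ioi_self h,
      ae_restrict_mem measurableSet_Ioo] with y hy hy'
    rcases mul_eq_zero.1 hy with h2 | h2
    · exact (ENNReal.ofReal_pos.2 (Real.rpow_pos_of_pos hy'.1 _)).ne' h2
    · rw [charDiffSq, sq_eq_zero_iff, enorm_eq_zero, sub_eq_zero] at h2
      exact fourierChar_ne_one hy'.1 hy'.2 h2
  rw [eventually_false_iff_eq_bot, ae_eq_bot, Measure.restrict_eq_zero] at h1
  simp at h1

/-- Near 0 the integrand is at most `(2π)² h^(1 - 2s)`, integrable as `s < 1`; beyond 1 it is at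
most `4 h^(-1 - 2s)`, integrable as `s > 0`. -/
theorem gagliardoConst_ne_top {s : ℝ} (h0 : 0 < s) (h1 : s < 1) : gagliardoConst s ≠ ∞ := by
  have hA : IntegrableOn (fun h : ℝ ↦ (2 * Real.pi) ^ 2 * h ^ (1 - 2 * s)) (Ioc 0 1) :=
    ((intervalIntegrable_iff_integrableOn_Ioc_of_le zero_le_one).1
      (intervalIntegral.intervalIntegrable_rpow' (by linarith))).const_mul _
  have hB : IntegrableOn (fun h : ℝ ↦ 4 * h ^ (-(1 + 2 * s))) (Ioi 1) :=
    (integrableOn_Ioi_rpow_of_lt (by linarith) one_pos).const_mul _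
  rw [gagliardoConst, ← Ioc_union_Ioi_eq_Ioi zero_le_one,
    lintegral_union measurableSet_Ioi (by
      rw [Set.disjoint_iff]; exact fun x hx ↦ absurd hx.1.2 (not_le.2 hx.2))]
  have key : ∀ h : ℝ, gagliardoKernel s h * charDiffSq h =
      ENNReal.ofReal (h ^ (-(1 + 2 * s))) *
        ENNReal.ofReal (‖((Real.fourierChar h : Circle) : ℂ) - 1‖ ^ 2) := fun h ↦ by
    rw [gagliardoKernel, charDiffSq, ENNReal.ofReal_pow (norm_nonneg _), ofReal_norm]
  refine ENNReal.add_ne_top.2 ⟨ne_top_of_le_ne_top hA.lintegral_lt_top.ne ?_,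
    ne_top_of_le_ne_top hB.lintegral_lt_top.ne ?_⟩
  · refine setLIntegral_mono' measurableSet_Ioc fun h hh ↦ ?_
    have hpos := Real.rpow_nonneg hh.1.le (-(1 + 2 * s))
    rw [key, ← ENNReal.ofReal_mul hpos]
    refine ENNReal.ofReal_le_ofReal ?_
    have h2 : ‖((Real.fourierChar h : Circle) : ℂ) - 1‖ ^ 2 ≤ (2 * Real.pi * h) ^ 2 :=
      pow_le_pow_left₀ (norm_nonneg _)
        ((norm_fourierChar_sub_one_le h).trans_eq (by rw [abs_of_pos hh.1])) 2
    refine (mul_le_mul_of_nonneg_left h2 hpos).trans_eq ?_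
    rw [show 1 - 2 * s = -(1 + 2 * s) + (2 : ℕ) by push_cast; ring,
      Real.rpow_add_natCast hh.1.ne']
    ring
  · refine setLIntegral_mono' measurableSet_Ioi fun h hh ↦ ?_
    have hpos := Real.rpow_nonneg (zero_le_one.trans (le_of_lt hh)) (-(1 + 2 * s))
    rw [key, ← ENNReal.ofReal_mul hpos, mul_comm]
    refine ENNReal.ofReal_le_ofReal (mul_le_mul_of_nonneg_right ?_ hpos)
    refine (pow_le_pow_left₀ (norm_nonneg _) (norm_fourierChar_sub_one_le_two h) 2).trans ?_
    norm_num

theorem lintegral_Ioi_comp_mul_right {f : ℝ → ℝ≥0∞} (hf : Measurable f) {a : ℝ} (ha : 0 < a) :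
    ENNReal.ofReal a * ∫⁻ h in Ioi 0, f (h * a) = ∫⁻ h in Ioi 0, f h := by
  have h1 : ∫⁻ h in Ioi 0, f (h * a) = ENNReal.ofReal a⁻¹ * ∫⁻ h in Ioi 0, f h := by
    have h2 := lintegral_map (μ := volume) (hf.indicator measurableSet_Ioi)
      (measurable_mul_const a) (f := (Ioi 0).indicator f)
    rw [Real.map_volume_mul_right ha.ne', lintegral_smul_measure, abs_of_pos (inv_pos.2 ha),
      lintegral_indicator measurableSet_Ioi] at h2
    rw [← smul_eq_mul, h2, ← lintegral_indicator measurableSet_Ioi]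
    refine lintegral_congr fun h ↦ ?_
    simp only [indicator, mem_Ioi, mul_pos_iff_of_pos_right ha]
  rw [h1, ← mul_assoc, ← ENNReal.ofReal_mul ha.le, mul_inv_cancel₀ ha.ne', ENNReal.ofReal_one,
    one_mul]

/-- Scaling `h ↦ h |ξ|`: the kernel contributes `|ξ|^(1 + 2s)`, the measure `|ξ|⁻¹`, and
`charDiffSq` is even. -/
theorem lintegral_gagliardoKernel_mul {s : ℝ} {ξ : ℝ} (hξ : ξ ≠ 0) :
    ∫⁻ h in Ioi 0, gagliardoKernel s h * charDiffSq (h * ξ) =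
      gagliardoConst s * ENNReal.ofReal (|ξ| ^ (2 * s)) := by
  have ha : 0 < |ξ| := abs_pos.2 hξ
  have h1 : ∀ h, charDiffSq (h * ξ) = charDiffSq (h * |ξ|) := fun h ↦ by
    rcases abs_choice ξ with h2 | h2 <;> rw [h2]
    rw [mul_neg, charDiffSq_neg]
  have h2 : ∀ h ∈ Ioi (0 : ℝ), gagliardoKernel s h * charDiffSq (h * ξ) =
      ENNReal.ofReal (|ξ| ^ (1 + 2 * s)) *
        (gagliardoKernel s (h * |ξ|) * charDiffSq (h * |ξ|)) := fun h hh ↦ by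
    rw [h1, ← mul_assoc]
    congr 1
    rw [gagliardoKernel, gagliardoKernel, ← ENNReal.ofReal_mul (by positivity),
      Real.mul_rpow (le_of_lt hh) ha.le, mul_left_comm, ← Real.rpow_add ha]
    simp
  have hm : Measurable fun h ↦ gagliardoKernel s h * charDiffSq h :=
    (measurable_gagliardoKernel s).mul measurable_charDiffSq
  have hm' : Measurable fun h ↦ gagliardoKernel s (h * |ξ|) * charDiffSq (h * |ξ|) :=
    hm.comp (measurable_mul_const |ξ|)
  rw [setLIntegral_congr_fun measurableSet_Ioi h2, lintegral_const_mul _ hm', gagliardoConst, ← lintegral_Ioi_comp_mul_right hm ha,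
    add_comm (1 : ℝ), Real.rpow_add_one ha.ne', ENNReal.ofReal_mul (by positivity)]
  ring

/-- The Gagliardo seminorm, squared. -/
noncomputable def gagliardo (s : ℝ) (u : ℝ → ℝ) : ℝ≥0∞ :=
  ∫⁻ h in Ioi 0, gagliardoKernel s h * ∫⁻ x, ‖u (x + h) - u x‖ₑ ^ 2

/-- Plancherel: translation by `h` is the multiplier `e^{2πihξ}`, so a difference becomes
multiplication by `e^{2πihξ} - 1`. -/
theorem lintegral_enorm_translate_sub_sq (u : Lp ℝ 2 (volume : Measure ℝ)) (h : ℝ) :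
    ∫⁻ x, ‖u (x + h) - u x‖ₑ ^ 2 = ∫⁻ ξ, charDiffSq (h * ξ) * ‖fourierL2 u ξ‖ₑ ^ 2 := by
  set τ := Lp.compMeasurePreserving (E := ℂ) (p := 2) (· + h)
    (measurePreserving_add_right volume h)
  have h1 := eLpNorm_l2Fourier (τ (complexify u) - complexify u)
  have h2 : ⇑(τ (complexify u) - complexify u) =ᵐ[volume] fun x ↦ ((u (x + h) - u x : ℝ) : ℂ) := by
    filter_upwards [Lp.coeFn_sub (τ (complexify u)) (complexify u), coeFn_complexify u,
      Lp.coeFn_compMeasurePreserving (complexify u) (measurePreserving_add_right volume h),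
      (measurePreserving_add_right volume h).quasiMeasurePreserving.ae (coeFn_complexify u)]
      with x a b c d
    rw [a, Pi.sub_apply, b, c, Function.comp_apply, d, Complex.ofReal_sub]
  have h3 : ⇑(l2Fourier (τ (complexify u) - complexify u)) =ᵐ[volume] fun ξ ↦
      (((Real.fourierChar (h * ξ) : Circle) : ℂ) - 1) * fourierL2 u ξ := by
    rw [map_sub]
    filter_upwards [Lp.coeFn_sub (l2Fourier (τ (complexify u))) (l2Fourier (complexify u)),
      l2Fourier_translate h (complexify u)] with ξ a b
    rw [a, Pi.sub_apply, b, fourierL2_apply]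
    ring
  rw [eLpNorm_congr_ae h2, eLpNorm_congr_ae h3] at h1
  have h4 := congrArg (· ^ 2) h1
  simp only [eLpNorm_two_sq, enorm_mul, mul_pow] at h4
  refine Eq.trans ?_ h4.symm
  refine lintegral_congr fun x ↦ ?_
  congr 1
  rw [enorm_eq_iff_norm_eq, Complex.norm_real]

/-- The homogeneous Sobolev seminorm, squared. -/
noncomputable def homSobolevSq (s : ℝ) (u : Lp ℝ 2 (volume : Measure ℝ)) : ℝ≥0∞ :=
  ∫⁻ ξ, ENNReal.ofReal (|ξ| ^ (2 * s)) * ‖fourierL2 u ξ‖ₑ ^ 2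

/-- Plancherel in `x` for each `h`, then Tonelli, then scaling in `h` for each `ξ ≠ 0`. -/
theorem gagliardo_eq (s : ℝ) (u : Lp ℝ 2 (volume : Measure ℝ)) :
    gagliardo s u = gagliardoConst s * homSobolevSq s u := by
  have hF : Measurable fun ξ ↦ ‖fourierL2 u ξ‖ₑ ^ 2 :=
    ((Lp.stronglyMeasurable (fourierL2 u)).measurable.enorm).pow_const 2
  have hm : Measurable fun p : ℝ × ℝ ↦
      gagliardoKernel s p.1 * (charDiffSq (p.1 * p.2) * ‖fourierL2 u p.2‖ₑ ^ 2) :=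
    ((measurable_gagliardoKernel s).comp measurable_fst).mul
      ((measurable_charDiffSq.comp (measurable_fst.mul measurable_snd)).mul
        (hF.comp measurable_snd))
  have hw : Measurable fun ξ : ℝ ↦ ENNReal.ofReal (|ξ| ^ (2 * s)) * ‖fourierL2 u ξ‖ₑ ^ 2 :=
    (measurable_norm.pow_const (2 * s)).ennreal_ofReal.mul hF
  calc gagliardo s u
      = ∫⁻ h in Ioi 0, ∫⁻ ξ, gagliardoKernel s h * (charDiffSq (h * ξ) * ‖fourierL2 u ξ‖ₑ ^ 2) := by
        refine lintegral_congr fun h ↦ ?_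
        rw [lintegral_enorm_translate_sub_sq, lintegral_const_mul]
        exact (measurable_charDiffSq.comp (measurable_const_mul h)).mul hF
    _ = ∫⁻ ξ, ∫⁻ h in Ioi 0,
          gagliardoKernel s h * (charDiffSq (h * ξ) * ‖fourierL2 u ξ‖ₑ ^ 2) :=
        lintegral_lintegral_swap hm.aemeasurable
    _ = ∫⁻ ξ, gagliardoConst s * (ENNReal.ofReal (|ξ| ^ (2 * s)) * ‖fourierL2 u ξ‖ₑ ^ 2) := by
        refine lintegral_congr_ae ?_
        filter_upwards [compl_mem_ae_iff.2 (measure_singleton (μ := volume) (0 : ℝ))] with ξ hξ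
        simp only [← mul_assoc]
        rw [lintegral_mul_const, lintegral_gagliardoKernel_mul hξ]
        exact (measurable_gagliardoKernel s).mul
          (measurable_charDiffSq.comp (measurable_mul_const ξ))
    _ = _ := lintegral_const_mul _ hw

theorem abs_rpow_two_mul (s ξ : ℝ) : |ξ| ^ (2 * s) = (ξ ^ 2) ^ s := by
  rw [Real.rpow_mul (abs_nonneg ξ), Real.rpow_two, sq_abs]

theorem homSobolevSq_le {s : ℝ} (hs : 0 ≤ s) (u : Lp ℝ 2 (volume : Measure ℝ)) :
    homSobolevSq s u ≤ eLpNorm (weightedFourier s u) 2 volume ^ 2 := by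
  rw [eLpNorm_weightedFourier_sq]
  refine lintegral_mono fun ξ ↦ mul_le_mul_left (ENNReal.ofReal_le_ofReal ?_) _
  rw [abs_rpow_two_mul]
  exact Real.rpow_le_rpow (sq_nonneg ξ) (by linarith) hs

/-- Subadditivity of `t ↦ t^s` for `0 ≤ s ≤ 1` gives `(1 + ξ²)^s ≤ 1 + |ξ|^(2s)`. -/
theorem eLpNorm_weightedFourier_sq_le {s : ℝ} (hs : 0 ≤ s) (hs1 : s ≤ 1)
    (u : Lp ℝ 2 (volume : Measure ℝ)) :
    eLpNorm (weightedFourier s u) 2 volume ^ 2 ≤ eLpNorm u 2 volume ^ 2 + homSobolevSq s u := by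
  rw [eLpNorm_weightedFourier_sq, ← eLpNorm_fourierL2, eLpNorm_two_sq, homSobolevSq,
    ← lintegral_add_left' ((Lp.memLp (fourierL2 u)).1.enorm.pow_const 2)]
  refine lintegral_mono fun ξ ↦ ?_
  have h1 : ENNReal.ofReal ((1 + ξ ^ 2) ^ s) ≤ 1 + ENNReal.ofReal (|ξ| ^ (2 * s)) := by
    rw [← ENNReal.ofReal_one, ← ENNReal.ofReal_add zero_le_one (by positivity), abs_rpow_two_mul]
    refine ENNReal.ofReal_le_ofReal ?_
    have := Real.rpow_add_le_add_rpow zero_le_one (sq_nonneg ξ) hs hs1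
    rwa [Real.one_rpow] at this
  refine (mul_le_mul_left h1 _).trans_eq ?_
  rw [add_mul, one_mul]

theorem ae_enorm_le_eLpNorm_top (f : ℝ → ℝ) : ∀ᵐ x, ‖f x‖ₑ ≤ eLpNorm f ∞ volume := by
  rw [eLpNorm_exponent_top]
  exact ae_le_eLpNormEssSup

theorem measurable_enorm_translate_sub_sq {u : ℝ → ℝ} (hu : Measurable u) :
    Measurable fun p : ℝ × ℝ ↦ ‖u (p.2 + p.1) - u p.2‖ₑ ^ 2 :=
  (((hu.comp (measurable_snd.add measurable_fst)).sub (hu.comp measurable_snd)).enorm).pow_const 2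

theorem lintegral_enorm_translate_sub_mul_sq_le {u v w : ℝ → ℝ} (hu : Measurable u)
    (hv : Measurable v) (hw : w =ᵐ[volume] fun x ↦ u x * v x) (h : ℝ) :
    ∫⁻ x, ‖w (x + h) - w x‖ₑ ^ 2 ≤
      2 * eLpNorm u ∞ volume ^ 2 * (∫⁻ x, ‖v (x + h) - v x‖ₑ ^ 2) +
      2 * eLpNorm v ∞ volume ^ 2 * ∫⁻ x, ‖u (x + h) - u x‖ₑ ^ 2 := by
  have hxu : Measurable fun x ↦ ‖u (x + h) - u x‖ₑ ^ 2 :=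
    (((hu.comp (measurable_add_const h)).sub hu).enorm).pow_const 2
  have hxv : Measurable fun x ↦ ‖v (x + h) - v x‖ₑ ^ 2 :=
    (((hv.comp (measurable_add_const h)).sub hv).enorm).pow_const 2
  rw [← lintegral_const_mul _ hxv, ← lintegral_const_mul _ hxu,
    ← lintegral_add_left (hxv.const_mul _)]
  refine lintegral_mono_ae ?_
  have hq := (measurePreserving_add_right (volume : Measure ℝ) h).quasiMeasurePreserving
  filter_upwards [hw, hq.ae hw, hq.ae (ae_enorm_le_eLpNorm_top u), ae_enorm_le_eLpNorm_top v]
    with x a b c d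
  have e : w (x + h) - w x = u (x + h) * (v (x + h) - v x) + v x * (u (x + h) - u x) := by
    rw [a, b]; ring
  rw [e]
  calc _ ≤ (eLpNorm u ∞ volume * ‖v (x + h) - v x‖ₑ +
        eLpNorm v ∞ volume * ‖u (x + h) - u x‖ₑ) ^ 2 := by
        refine pow_le_pow_left₀ zero_le ((enorm_add_le _ _).trans ?_) 2
        rw [enorm_mul, enorm_mul]
        exact add_le_add (mul_le_mul_left c _) (mul_le_mul_left d _)
    _ ≤ _ := by
        refine (ennreal_add_sq_le _ _).trans_eq ?_
        ring

theorem gagliardo_mul_le (s : ℝ) {u v w : ℝ → ℝ} (hu : Measurable u) (hv : Measurable v)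
    (hw : w =ᵐ[volume] fun x ↦ u x * v x) :
    gagliardo s w ≤ 2 * eLpNorm u ∞ volume ^ 2 * gagliardo s v +
      2 * eLpNorm v ∞ volume ^ 2 * gagliardo s u := by
  have hK : ∀ {u : ℝ → ℝ}, Measurable u → Measurable fun h ↦
      gagliardoKernel s h * ∫⁻ x, ‖u (x + h) - u x‖ₑ ^ 2 := fun hu ↦
    (measurable_gagliardoKernel s).mul
      (measurable_enorm_translate_sub_sq hu).lintegral_prod_right'
  rw [gagliardo, gagliardo, gagliardo, ← lintegral_const_mul _ (hK hv),
    ← lintegral_const_mul _ (hK hu), ← lintegral_add_left ((hK hv).const_mul _)]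
  refine lintegral_mono fun h ↦ ?_
  refine (mul_le_mul_right (lintegral_enorm_translate_sub_mul_sq_le hu hv hw h) _).trans_eq ?_
  ring

theorem eLpNorm_mul_le {u v w : Lp ℝ 2 (volume : Measure ℝ)}
    (hw : ⇑w =ᵐ[volume] fun x ↦ u x * v x) :
    eLpNorm w 2 volume ≤ eLpNorm u ∞ volume * eLpNorm v 2 volume := by
  rw [eLpNorm_congr_ae hw]
  exact eLpNorm_smul_le_eLpNorm_top_mul_eLpNorm 2 (Lp.memLp v).1 u

/-- `H^s ∩ L^∞` is closed under products for `0 < s < 1`. -/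
theorem eLpNorm_weightedFourier_mul_sq_le_of_lt_one {s : ℝ} (h0 : 0 < s) (h1 : s < 1)
    {u v w : Lp ℝ 2 (volume : Measure ℝ)} (hw : ⇑w =ᵐ[volume] fun x ↦ u x * v x) :
    eLpNorm (weightedFourier s w) 2 volume ^ 2 ≤
      3 * eLpNorm u ∞ volume ^ 2 * eLpNorm (weightedFourier s v) 2 volume ^ 2 +
      2 * eLpNorm v ∞ volume ^ 2 * eLpNorm (weightedFourier s u) 2 volume ^ 2 := by
  have hG := gagliardo_mul_le s (Lp.stronglyMeasurable u).measurable
    (Lp.stronglyMeasurable v).measurable hw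
  rw [gagliardo_eq, gagliardo_eq, gagliardo_eq] at hG
  have hH : homSobolevSq s w ≤ 2 * eLpNorm u ∞ volume ^ 2 * homSobolevSq s v +
      2 * eLpNorm v ∞ volume ^ 2 * homSobolevSq s u := by
    -- The Gagliardo estimate passes to the Fourier side by cancelling the constant, which must be
    -- neither 0 nor `∞`.
    refine (ENNReal.mul_le_mul_iff_right (gagliardoConst_ne_zero s)
      (gagliardoConst_ne_top h0 h1)).1 (hG.trans_eq ?_)
    ring
  calc _ ≤ eLpNorm w 2 volume ^ 2 + homSobolevSq s w := eLpNorm_weightedFourier_sq_le h0.le h1.le w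
    _ ≤ (eLpNorm u ∞ volume * eLpNorm (weightedFourier s v) 2 volume) ^ 2 +
        (2 * eLpNorm u ∞ volume ^ 2 * eLpNorm (weightedFourier s v) 2 volume ^ 2 +
        2 * eLpNorm v ∞ volume ^ 2 * eLpNorm (weightedFourier s u) 2 volume ^ 2) := by
        gcongr
        · refine (eLpNorm_mul_le hw).trans ?_
          gcongr
          exact eLpNorm_le_eLpNorm_weightedFourier v h0.le
        · refine hH.trans ?_
          gcongr <;> exact homSobolevSq_le h0.le _
    _ = _ := by ring

end Gagliardo
-- Products for `s ≥ 1`: convolution of Fourier transforms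
/-- On `L¹ ∩ L²` the inverse Fourier transform of `L²` is given by the Fourier integral. -/
theorem l2Fourier_symm_toLp_ae_eq {f : ℝ → ℂ} (hf : Integrable f) (hf2 : MemLp f 2) :
    ⇑(l2Fourier.symm (hf2.toLp f)) =ᵐ[volume] 𝓕⁻ f := by
  have hc : Continuous (𝓕⁻ f) := by
    rw [Real.fourierInv_eq_fourier_comp_neg]
    exact continuous_fourier_of_integrable hf.comp_neg
  refine ae_eq_of_integral_contDiff_smul_eq ((Lp.memLp _).locallyIntegrable one_le_two)
    hc.locallyIntegrable fun φ hφ hs ↦ ?_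
  have h1 : HasCompactSupport (fun x ↦ (φ x : ℂ)) := hs.comp_left Complex.ofReal_zero
  have h2 : ContDiff ℝ (⊤ : ℕ∞) (fun x ↦ (φ x : ℂ)) := Complex.ofRealCLM.contDiff.comp hφ
  set Φ := h1.toSchwartzMap h2
  have hΦ : ∀ x, Φ x = (φ x : ℂ) := fun x ↦ rfl
  have h3 := DFunLike.congr_fun (Lp.fourierInv_toTemperedDistribution_eq (hf2.toLp f)) Φ
  rw [TemperedDistribution.fourierInv_apply, Lp.toTemperedDistribution_apply,
    Lp.toTemperedDistribution_apply, SchwartzMap.fourierInv_coe] at h3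
  have h4 := VectorFourier.integral_fourierIntegral_smul_eq_flip (e := Real.fourierChar)
    (μ := volume) (ν := volume) (L := -innerₗ ℝ) (f := Φ) (g := f)
    Real.continuous_fourierChar (by simpa using! continuous_inner.neg) Φ.integrable hf
  have h5 : ∫ x, 𝓕⁻ (Φ : ℝ → ℂ) x • (hf2.toLp f) x = ∫ x, 𝓕⁻ (Φ : ℝ → ℂ) x • f x := by
    refine integral_congr_ae ?_
    filter_upwards [hf2.coeFn_toLp] with x hx
    rw [hx]
  rw [h5] at h3
  have h6 : (-innerₗ ℝ).flip = -innerₗ ℝ := by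
    ext; simp
  simp only [hΦ, h6, Complex.real_smul.symm, smul_eq_mul] at h3 h4
  exact h3.symm.trans h4

/-- The Fourier transform of a product is a convolution, for `U, V ∈ L²` with integrable Fourier
transforms. -/
theorem l2Fourier_mul_ae_eq {U V W : Lp ℂ 2 (volume : Measure ℝ)}
    (hU : Integrable (l2Fourier U)) (hV : Integrable (l2Fourier V))
    (hW : ⇑W =ᵐ[volume] fun x ↦ U x * V x) :
    ⇑(l2Fourier W) =ᵐ[volume] fun ξ ↦ ∫ t, l2Fourier U t * l2Fourier V (ξ - t) := by
  have h2 := memLp_conv hU (Lp.memLp (l2Fourier V))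
  have h1 : Integrable (fun ξ ↦ ∫ t, l2Fourier U t * l2Fourier V (ξ - t)) :=
    hU.integrable_convolution (ContinuousLinearMap.mul ℂ ℂ) hV
  have hinv : ∀ U : Lp ℂ 2 (volume : Measure ℝ), Integrable (l2Fourier U) →
      ⇑U =ᵐ[volume] 𝓕⁻ (l2Fourier U : ℝ → ℂ) := fun U hU ↦ by
    have := l2Fourier_symm_toLp_ae_eq hU (Lp.memLp _)
    rwa [Lp.toLp_coeFn, LinearIsometryEquiv.symm_apply_apply] at this
  -- The convolution lies in `L¹ ∩ L²`, so its inverse transform is a Fourier integral, equal to the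
  -- product of those of the factors.
  have h3 : W = l2Fourier.symm (h2.toLp _) := by
    refine Lp.ext ?_
    filter_upwards [hW, hinv U hU, hinv V hV, l2Fourier_symm_toLp_ae_eq h1 h2] with x a b c d
    rw [a, d, b, c]
    simp only [Real.fourierInv_eq_fourier_neg]
    exact (Real.fourier_mul_convolution_eq hU hV (-x)).symm
  rw [h3, LinearIsometryEquiv.apply_symm_apply]
  exact h2.coeFn_toLp

/-- `∫ (1 + ξ²)⁻¹ dξ`. -/
noncomputable def invOneAddSqMass : ℝ≥0∞ := ∫⁻ ξ : ℝ, ENNReal.ofReal ((1 + ξ ^ 2)⁻¹)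

theorem invOneAddSqMass_ne_top : invOneAddSqMass ≠ ∞ := integrable_inv_one_add_sq.lintegral_lt_top.ne

/-- Cauchy–Schwarz for the finite measure `(1 + ξ²)⁻¹ dξ` applied to `(1 + ξ²) |û|`, followed by `1
+ ξ² ≤ (1 + ξ²)^s`. -/
theorem lintegral_enorm_fourierL2_sq_le {s : ℝ} (hs : 1 ≤ s) (u : Lp ℝ 2 (volume : Measure ℝ)) :
    (∫⁻ ξ, ‖fourierL2 u ξ‖ₑ) ^ 2 ≤
      invOneAddSqMass * eLpNorm (weightedFourier s u) 2 volume ^ 2 := by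
  have hF : Measurable fun ξ ↦ ‖fourierL2 u ξ‖ₑ :=
    (Lp.stronglyMeasurable (fourierL2 u)).measurable.enorm
  have hm : Measurable fun ξ : ℝ ↦ ENNReal.ofReal ((1 + ξ ^ 2)⁻¹) := by fun_prop
  have hm' : Measurable fun ξ : ℝ ↦ ENNReal.ofReal (1 + ξ ^ 2) := by fun_prop
  have h := lintegral_mul_sq_le (μ := volume) hm.aemeasurable (hm'.mul hF).aemeasurable
  have hinv : ∀ ξ : ℝ, ENNReal.ofReal ((1 + ξ ^ 2)⁻¹) * ENNReal.ofReal (1 + ξ ^ 2) = 1 := fun ξ ↦ by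
    rw [← ENNReal.ofReal_mul (by positivity), inv_mul_cancel₀ (by positivity), ENNReal.ofReal_one]
  have e1 : ∀ ξ : ℝ, ENNReal.ofReal ((1 + ξ ^ 2)⁻¹) *
      (ENNReal.ofReal (1 + ξ ^ 2) * ‖fourierL2 u ξ‖ₑ) = ‖fourierL2 u ξ‖ₑ := fun ξ ↦ by
    rw [← mul_assoc, hinv, one_mul]
  have e2 : ∀ ξ : ℝ, ENNReal.ofReal ((1 + ξ ^ 2)⁻¹) *
      (ENNReal.ofReal (1 + ξ ^ 2) * ‖fourierL2 u ξ‖ₑ) ^ 2 =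
        ENNReal.ofReal (1 + ξ ^ 2) * ‖fourierL2 u ξ‖ₑ ^ 2 := fun ξ ↦ by
    rw [pow_two (ENNReal.ofReal (1 + ξ ^ 2) * ‖fourierL2 u ξ‖ₑ), ← mul_assoc, e1]
    ring
  simp only [Pi.mul_apply, e1, e2] at h
  refine h.trans (mul_le_mul_right ?_ _)
  rw [eLpNorm_weightedFourier_sq]
  refine lintegral_mono fun ξ ↦ mul_le_mul_left (ENNReal.ofReal_le_ofReal ?_) _
  exact Real.self_le_rpow_of_one_le (by nlinarith [sq_nonneg ξ]) hs

theorem integrable_fourierL2 {s : ℝ} (hs : 1 ≤ s) {u : Lp ℝ 2 (volume : Measure ℝ)}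
    (hu : eLpNorm (weightedFourier s u) 2 volume ≠ ∞) : Integrable (fourierL2 u) := by
  refine ⟨(Lp.memLp (fourierL2 u)).1, ?_⟩
  have h : (∫⁻ ξ, ‖fourierL2 u ξ‖ₑ) ^ 2 < ∞ := (lintegral_enorm_fourierL2_sq_le hs u).trans_lt
    (ENNReal.mul_lt_top invOneAddSqMass_ne_top.lt_top (ENNReal.pow_lt_top hu.lt_top))
  exact (ENNReal.pow_lt_top_iff.1 h).resolve_right two_ne_zero

/-- With `ξ = t + (ξ - t)`, the larger of `1 + t²` and `1 + (ξ - t)²` is at least a quarter of `1 +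
ξ²`. This distributes the weight over the two factors of a convolution. -/
theorem weight_le {s : ℝ} (hs : 0 ≤ s) (ξ t : ℝ) :
    (1 + ξ ^ 2) ^ (s / 2) ≤
      4 ^ (s / 2) * ((1 + t ^ 2) ^ (s / 2) + (1 + (ξ - t) ^ 2) ^ (s / 2)) := by
  have h1 : 1 + ξ ^ 2 ≤ 4 * max (1 + t ^ 2) (1 + (ξ - t) ^ 2) := by
    have h2 := le_max_left (1 + t ^ 2) (1 + (ξ - t) ^ 2)
    have h3 := le_max_right (1 + t ^ 2) (1 + (ξ - t) ^ 2)
    nlinarith [sq_nonneg (2 * t - ξ)]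
  have hm : 0 ≤ max (1 + t ^ 2) (1 + (ξ - t) ^ 2) := le_max_of_le_left (by positivity)
  refine (Real.rpow_le_rpow (by positivity) h1 (by positivity)).trans ?_
  rw [Real.mul_rpow (by norm_num) hm]
  refine mul_le_mul_of_nonneg_left ?_ (by positivity)
  rcases max_choice (1 + t ^ 2) (1 + (ξ - t) ^ 2) with h | h <;> rw [h]
  · exact le_add_of_nonneg_right (by positivity)
  · exact le_add_of_nonneg_left (by positivity)

theorem enorm_weightedFourier_mul_le {s : ℝ} (hs : 1 ≤ s)
    {u v w : Lp ℝ 2 (volume : Measure ℝ)}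
    (hu : eLpNorm (weightedFourier s u) 2 volume ≠ ∞)
    (hv : eLpNorm (weightedFourier s v) 2 volume ≠ ∞) (hw : ⇑w =ᵐ[volume] fun x ↦ u x * v x) :
    ∀ᵐ ξ, ‖weightedFourier s w ξ‖ₑ ≤ ENNReal.ofReal (4 ^ (s / 2)) *
      ((∫⁻ t, ‖fourierL2 v t‖ₑ * ‖weightedFourier s u (ξ - t)‖ₑ) +
        ∫⁻ t, ‖fourierL2 u t‖ₑ * ‖weightedFourier s v (ξ - t)‖ₑ) := by
  have hF : ∀ u : Lp ℝ 2 (volume : Measure ℝ), Measurable fun ξ ↦ ‖fourierL2 u ξ‖ₑ :=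
    fun u ↦ (Lp.stronglyMeasurable (fourierL2 u)).measurable.enorm
  have hWm : ∀ u : Lp ℝ 2 (volume : Measure ℝ), Measurable fun ξ ↦ ‖weightedFourier s u ξ‖ₑ :=
    fun u ↦ by
      simp only [enorm_weightedFourier]
      exact (continuous_one_add_sq_rpow (s / 2)).measurable.ennreal_ofReal.mul (hF u)
  have hW : ⇑(complexify w) =ᵐ[volume] fun x ↦ complexify u x * complexify v x := by
    filter_upwards [coeFn_complexify w, coeFn_complexify u, coeFn_complexify v, hw] with x a b c d
    rw [a, b, c, d, Complex.ofReal_mul]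
  filter_upwards [l2Fourier_mul_ae_eq (integrable_fourierL2 hs hu) (integrable_fourierL2 hs hv) hW]
    with ξ hξ
  -- The convolution is flipped so that in both terms of the statement the unweighted transform,
  -- which is in `L¹`, comes first, as Young's inequality expects.
  have e1 : ∫⁻ t, ‖fourierL2 v t‖ₑ * ‖weightedFourier s u (ξ - t)‖ₑ =
      ∫⁻ t, ‖weightedFourier s u t‖ₑ * ‖fourierL2 v (ξ - t)‖ₑ := by
    rw [← lintegral_sub_left_eq_self _ ξ]
    simp only [sub_sub_cancel, mul_comm]
  have hm : Measurable fun t ↦ ‖weightedFourier s u t‖ₑ * ‖fourierL2 v (ξ - t)‖ₑ :=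
    (hWm u).mul ((hF v).comp (measurable_const_sub ξ))
  rw [e1, ← lintegral_add_left hm, ← lintegral_const_mul' _ _ ENNReal.ofReal_ne_top,
    enorm_weightedFourier]
  have h1 : ‖fourierL2 w ξ‖ₑ ≤ ∫⁻ t, ‖fourierL2 u t‖ₑ * ‖fourierL2 v (ξ - t)‖ₑ := by
    rw [fourierL2_apply, hξ]
    refine (enorm_integral_le_lintegral_enorm _).trans_eq ?_
    simp only [enorm_mul]
    rfl
  refine (mul_le_mul_right h1 _).trans ?_
  rw [← lintegral_const_mul' _ _ ENNReal.ofReal_ne_top]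
  refine lintegral_mono fun t ↦ ?_
  have h2 : ENNReal.ofReal ((1 + ξ ^ 2) ^ (s / 2)) ≤ ENNReal.ofReal (4 ^ (s / 2)) *
      (ENNReal.ofReal ((1 + t ^ 2) ^ (s / 2)) + ENNReal.ofReal ((1 + (ξ - t) ^ 2) ^ (s / 2))) := by
    rw [← ENNReal.ofReal_add (by positivity) (by positivity), ← ENNReal.ofReal_mul (by positivity)]
    exact ENNReal.ofReal_le_ofReal (weight_le (by linarith) ξ t)
  refine (mul_le_mul_left h2 _).trans_eq ?_
  simp only [enorm_weightedFourier]
  ring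

/-- `H^s` is closed under products for `s ≥ 1`. -/
theorem eLpNorm_weightedFourier_mul_sq_le_of_one_le {s : ℝ} (hs : 1 ≤ s)
    {u v w : Lp ℝ 2 (volume : Measure ℝ)}
    (hu : eLpNorm (weightedFourier s u) 2 volume ≠ ∞)
    (hv : eLpNorm (weightedFourier s v) 2 volume ≠ ∞) (hw : ⇑w =ᵐ[volume] fun x ↦ u x * v x) :
    eLpNorm (weightedFourier s w) 2 volume ^ 2 ≤
      4 * ENNReal.ofReal (4 ^ (s / 2)) ^ 2 * invOneAddSqMass *
        (eLpNorm (weightedFourier s u) 2 volume * eLpNorm (weightedFourier s v) 2 volume) ^ 2 := by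
  have hF : ∀ u : Lp ℝ 2 (volume : Measure ℝ), AEMeasurable fun ξ ↦ ‖fourierL2 u ξ‖ₑ :=
    fun u ↦ (Lp.memLp (fourierL2 u)).1.enorm
  have hWm : ∀ u : Lp ℝ 2 (volume : Measure ℝ), AEMeasurable fun ξ ↦ ‖weightedFourier s u ξ‖ₑ :=
    fun u ↦ (aestronglyMeasurable_weightedFourier u s).enorm
  have hc : ∀ u v : Lp ℝ 2 (volume : Measure ℝ),
      ∫⁻ ξ, (∫⁻ t, ‖fourierL2 v t‖ₑ * ‖weightedFourier s u (ξ - t)‖ₑ) ^ 2 ≤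
        invOneAddSqMass *
        (eLpNorm (weightedFourier s u) 2 volume * eLpNorm (weightedFourier s v) 2 volume) ^ 2 :=
    fun u v ↦ by
      refine (lintegral_conv_sq_le (hF v) (hWm u)).trans ?_
      rw [← eLpNorm_two_sq]
      refine (mul_le_mul_left (lintegral_enorm_fourierL2_sq_le hs v) _).trans_eq ?_
      ring
  have hmc : AEMeasurable fun ξ ↦ ∫⁻ t, ‖fourierL2 v t‖ₑ * ‖weightedFourier s u (ξ - t)‖ₑ := by
    refine AEMeasurable.lintegral_prod_right' (f := fun p : ℝ × ℝ ↦
      ‖fourierL2 v p.2‖ₑ * ‖weightedFourier s u (p.1 - p.2)‖ₑ) ?_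
    exact ((hF v).comp_quasiMeasurePreserving Measure.quasiMeasurePreserving_snd).mul
      ((hWm u).comp_quasiMeasurePreserving (quasiMeasurePreserving_sub volume volume))
  rw [eLpNorm_two_sq]
  calc ∫⁻ ξ, ‖weightedFourier s w ξ‖ₑ ^ 2
      ≤ ∫⁻ ξ, ENNReal.ofReal (4 ^ (s / 2)) ^ 2 *
        (2 * (∫⁻ t, ‖fourierL2 v t‖ₑ * ‖weightedFourier s u (ξ - t)‖ₑ) ^ 2 +
          2 * (∫⁻ t, ‖fourierL2 u t‖ₑ * ‖weightedFourier s v (ξ - t)‖ₑ) ^ 2) := by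
        refine lintegral_mono_ae ?_
        filter_upwards [enorm_weightedFourier_mul_le hs hu hv hw] with ξ hξ
        refine (pow_le_pow_left₀ zero_le hξ 2).trans ?_
        rw [mul_pow]
        exact mul_le_mul_right (ennreal_add_sq_le _ _) _
    _ = ENNReal.ofReal (4 ^ (s / 2)) ^ 2 *
        (2 * (∫⁻ ξ, (∫⁻ t, ‖fourierL2 v t‖ₑ * ‖weightedFourier s u (ξ - t)‖ₑ) ^ 2) +
          2 * ∫⁻ ξ, (∫⁻ t, ‖fourierL2 u t‖ₑ * ‖weightedFourier s v (ξ - t)‖ₑ) ^ 2) := by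
        rw [lintegral_const_mul' _ _ (ENNReal.pow_ne_top ENNReal.ofReal_ne_top),
          lintegral_add_left' ((hmc.pow_const 2).const_mul 2),
          lintegral_const_mul' _ _ ENNReal.ofNat_ne_top,
          lintegral_const_mul' _ _ ENNReal.ofNat_ne_top]
    _ ≤ ENNReal.ofReal (4 ^ (s / 2)) ^ 2 * (2 * (invOneAddSqMass *
        (eLpNorm (weightedFourier s u) 2 volume * eLpNorm (weightedFourier s v) 2 volume) ^ 2) +
          2 * (invOneAddSqMass *
        (eLpNorm (weightedFourier s v) 2 volume * eLpNorm (weightedFourier s u) 2 volume) ^ 2)) :=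
        mul_le_mul_right (add_le_add (mul_le_mul_right (hc u v) _)
          (mul_le_mul_right (hc v u) _)) _
    _ = _ := by ring

/-- `H^s ∩ L^∞` is closed under products for `s > 0`. -/
theorem exists_eLpNorm_weightedFourier_mul_le {s : ℝ} (hs : 0 < s) :
    ∃ D : ℝ≥0∞, D ≠ ∞ ∧ ∀ {u v w : Lp ℝ 2 (volume : Measure ℝ)},
      eLpNorm (weightedFourier s u) 2 volume ≠ ∞ → eLpNorm (weightedFourier s v) 2 volume ≠ ∞ →
      (⇑w =ᵐ[volume] fun x ↦ u x * v x) →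
      eLpNorm (weightedFourier s w) 2 volume ≤ D *
        ((eLpNorm (weightedFourier s u) 2 volume + eLpNorm u ∞ volume) *
          (eLpNorm (weightedFourier s v) 2 volume + eLpNorm v ∞ volume)) := by
  obtain ⟨D, hD, h⟩ : ∃ D : ℝ≥0∞, D ≠ ∞ ∧ ∀ {u v w : Lp ℝ 2 (volume : Measure ℝ)},
      eLpNorm (weightedFourier s u) 2 volume ≠ ∞ → eLpNorm (weightedFourier s v) 2 volume ≠ ∞ →
      (⇑w =ᵐ[volume] fun x ↦ u x * v x) →
      eLpNorm (weightedFourier s w) 2 volume ^ 2 ≤ D *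
        ((eLpNorm (weightedFourier s u) 2 volume + eLpNorm u ∞ volume) *
          (eLpNorm (weightedFourier s v) 2 volume + eLpNorm v ∞ volume)) ^ 2 := by
    rcases lt_or_ge s 1 with h1 | h1
    · refine ⟨5, by norm_num, fun {u v w} hu hv hw ↦ ?_⟩
      refine (eLpNorm_weightedFourier_mul_sq_le_of_lt_one hs h1 hw).trans ?_
      rw [show (5 : ℝ≥0∞) = 3 + 2 by norm_num, add_mul, mul_assoc, mul_assoc, ← mul_pow, ← mul_pow,
        mul_comm (eLpNorm v ∞ volume)]
      gcongr
      · exact le_add_self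
      · exact le_self_add
      · exact le_self_add
      · exact le_add_self
    · refine ⟨4 * ENNReal.ofReal (4 ^ (s / 2)) ^ 2 * invOneAddSqMass, ?_, fun {u v w} hu hv hw ↦
        (eLpNorm_weightedFourier_mul_sq_le_of_one_le h1 hu hv hw).trans ?_⟩
      · exact ENNReal.mul_ne_top (ENNReal.mul_ne_top (by norm_num)
          (ENNReal.pow_ne_top ENNReal.ofReal_ne_top)) invOneAddSqMass_ne_top
      · gcongr <;> exact le_self_add
  -- `D ≤ (D + 1)²`, so `D + 1` serves as a constant for the unsquared inequality.
  refine ⟨D + 1, ENNReal.add_ne_top.2 ⟨hD, ENNReal.one_ne_top⟩, fun hu hv hw ↦ ?_⟩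
  rw [← ENNReal.pow_le_pow_left_iff two_ne_zero, mul_pow]
  refine (h hu hv hw).trans (mul_le_mul_left ?_ _)
  calc D ≤ D + 1 := le_self_add
    _ ≤ (D + 1) ^ 2 := le_self_pow₀ le_add_self two_ne_zero

end Peridynamic

namespace Peridynamic
-- Completeness of `H^s ∩ L^∞`
namespace HsLinf

variable {s : ℝ}

theorem ext_ae {u v : HsLinf s} (h : ⇑u =ᵐ[volume] ⇑v) : u = v :=
  Subtype.ext (Lp.ext h)

theorem coeFn_add (u v : HsLinf s) : ⇑(u + v) =ᵐ[volume] fun x ↦ u x + v x :=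
  Lp.coeFn_add u.toL2 v.toL2

theorem coeFn_sub (u v : HsLinf s) : ⇑(u - v) =ᵐ[volume] fun x ↦ u x - v x :=
  Lp.coeFn_sub u.toL2 v.toL2

theorem coeFn_smul (c : ℝ) (u : HsLinf s) : ⇑(c • u) =ᵐ[volume] fun x ↦ c * u x :=
  Lp.coeFn_smul c u.toL2

/-- An `L²` function with finite `H^s` and `L^∞` norms. -/
def mk (u : Lp ℝ 2 (volume : Measure ℝ)) (h1 : MemLp (weightedFourier s u) 2 volume)
    (h2 : MemLp u ∞ volume) : HsLinf s := ⟨u, h1, h2⟩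

/-- The two parts of the norm, in `[0, ∞]`. -/
theorem enorm_eq (u : HsLinf s) : ‖u‖ₑ =
    eLpNorm (weightedFourier s u.toL2) 2 volume + eLpNorm (u : ℝ → ℝ) ∞ volume := by
  rw [← ofReal_norm, norm_def, sobolevNorm_eq, supNorm,
    ENNReal.ofReal_add ENNReal.toReal_nonneg ENNReal.toReal_nonneg,
    ENNReal.ofReal_toReal (memLp_weightedFourier u).2.ne, ENNReal.ofReal_toReal (memLp_top u).2.ne]

theorem eLpNorm_weightedFourier_le (u : HsLinf s) :
    eLpNorm (weightedFourier s u.toL2) 2 volume ≤ ‖u‖ₑ := by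
  rw [enorm_eq]
  exact le_self_add

theorem eLpNorm_top_le (u : HsLinf s) : eLpNorm (u : ℝ → ℝ) ∞ volume ≤ ‖u‖ₑ := by
  rw [enorm_eq]
  exact le_add_self

theorem eLpNorm_two_le (hs : 0 ≤ s) (u : HsLinf s) : eLpNorm (u : ℝ → ℝ) 2 volume ≤ ‖u‖ₑ :=
  (eLpNorm_le_eLpNorm_weightedFourier u.toL2 hs).trans u.eLpNorm_weightedFourier_le

theorem weightedFourier_sub (u v : Lp ℝ 2 (volume : Measure ℝ)) :
    weightedFourier s (u - v) =ᵐ[volume] weightedFourier s u - weightedFourier s v := by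
  filter_upwards [Lp.coeFn_sub (fourierL2 u) (fourierL2 v)] with ξ hξ
  simp only [weightedFourier, map_sub, Pi.sub_apply, hξ, smul_sub]

theorem tendsto_of_eLpNorm {p : ℝ≥0∞} [Fact (1 ≤ p)] {E : Type*} [NormedAddCommGroup E]
    {f : ℕ → Lp E p (volume : Measure ℝ)} {g : Lp E p (volume : Measure ℝ)}
    (h : Tendsto f atTop (𝓝 g)) : ∃ ns : ℕ → ℕ, StrictMono ns ∧
      ∀ᵐ x, Tendsto (fun i ↦ f (ns i) x) atTop (𝓝 (g x)) :=
  (tendstoInMeasure_of_tendsto_Lp h).exists_seq_tendsto_ae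

/-- A Cauchy sequence converges in `L²`, its weighted transforms converge in `L²`, and it converges
in `L^∞`. The three limits belong to one function because subsequences converge almost everywhere.
-/
theorem completeSpace (hs : 0 ≤ s) : CompleteSpace (HsLinf s) := by
  refine Metric.complete_of_cauchySeq_tendsto fun u hu ↦ ?_
  have hcauchy : ∀ {p : ℝ≥0∞} [Fact (1 ≤ p)] {E : Type} [NormedAddCommGroup E] [CompleteSpace E]
      (Φ : HsLinf s → Lp E p (volume : Measure ℝ)), (∀ v w, ‖Φ v - Φ w‖ₑ ≤ ‖v - w‖ₑ) →
      ∃ g, Tendsto (fun n ↦ Φ (u n)) atTop (𝓝 g) := fun Φ hΦ ↦ by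
    refine cauchySeq_tendsto_of_complete (hu.map (LipschitzWith.uniformContinuous (K := 1) ?_))
    intro v w
    rw [ENNReal.coe_one, one_mul, edist_eq_enorm_sub, edist_eq_enorm_sub]
    exact hΦ v w
  obtain ⟨u₂, h₂⟩ := hcauchy toL2 fun v w ↦ by
    rw [Lp.enorm_def]
    exact eLpNorm_two_le hs (v - w)
  obtain ⟨g, hg⟩ := hcauchy (fun v ↦ (memLp_weightedFourier v).toLp _) fun v w ↦ by
    rw [← MemLp.toLp_sub, Lp.enorm_toLp, ← eLpNorm_congr_ae (weightedFourier_sub _ _)]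
    exact eLpNorm_weightedFourier_le (v - w)
  obtain ⟨b, hb⟩ := hcauchy (fun v ↦ (memLp_top v).toLp _) fun v w ↦ by
    rw [← MemLp.toLp_sub, Lp.enorm_toLp, ← eLpNorm_congr_ae (Lp.coeFn_sub v.toL2 w.toL2)]
    exact eLpNorm_top_le (v - w)
  have hub : ⇑u₂ =ᵐ[volume] ⇑b := by
    obtain ⟨ns, hns, h⟩ := tendsto_of_eLpNorm h₂
    obtain ⟨ms, hms, h'⟩ := tendsto_of_eLpNorm (hb.comp hns.tendsto_atTop)
    have h3 : ∀ᵐ x, ∀ n, (memLp_top (u n)).toLp _ x = u n x :=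
      ae_all_iff.2 fun n ↦ (memLp_top (u n)).coeFn_toLp
    filter_upwards [h, h', h3] with x a b c
    simp only [Function.comp_apply, c] at b
    exact tendsto_nhds_unique (a.comp hms.tendsto_atTop) b
  have hF : Continuous fourierL2 :=
    l2Fourier.continuous.comp (Complex.ofRealCLM.compLpL 2 volume).continuous
  have hug : weightedFourier s u₂ =ᵐ[volume] ⇑g := by
    obtain ⟨ns, hns, h⟩ := tendsto_of_eLpNorm ((hF.tendsto u₂).comp h₂)
    obtain ⟨ms, hms, h'⟩ := tendsto_of_eLpNorm (hg.comp hns.tendsto_atTop)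
    have h3 : ∀ᵐ ξ, ∀ n, (memLp_weightedFourier (u n)).toLp _ ξ =
        weightedFourier s (u n).toL2 ξ :=
      ae_all_iff.2 fun n ↦ (memLp_weightedFourier (u n)).coeFn_toLp
    filter_upwards [h, h', h3] with ξ a b c
    simp only [Function.comp_apply, c] at b
    exact tendsto_nhds_unique ((a.comp hms.tendsto_atTop).const_smul _) b
  refine ⟨mk u₂ ((memLp_congr_ae hug).2 (Lp.memLp g)) ((memLp_congr_ae hub).2 (Lp.memLp b)), ?_⟩
  rw [tendsto_iff_edist_tendsto_0] at hg hb ⊢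
  have h := hg.add hb
  rw [add_zero] at h
  refine h.congr fun n ↦ ?_
  rw [edist_eq_enorm_sub, edist_eq_enorm_sub, edist_eq_enorm_sub, enorm_eq, Lp.enorm_def,
    Lp.enorm_def]
  congr 1
  · refine eLpNorm_congr_ae ?_
    filter_upwards [Lp.coeFn_sub ((memLp_weightedFourier (u n)).toLp _) g, hug,
      weightedFourier_sub (s := s) (u n).toL2 u₂, (memLp_weightedFourier (u n)).coeFn_toLp]
      with ξ a b c d
    rw [a, Pi.sub_apply, d, ← b]
    exact c.symm
  · refine eLpNorm_congr_ae ?_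
    filter_upwards [Lp.coeFn_sub ((memLp_top (u n)).toLp _) b, hub,
      Lp.coeFn_sub (u n).toL2 u₂, (memLp_top (u n)).coeFn_toLp]
      with ξ a b c d
    rw [a, Pi.sub_apply, d, ← b]
    exact c.symm

end HsLinf
-- Maps that are Lipschitz on bounded sets
section LipschitzOnBounded

variable {E G : Type*} [NormedAddCommGroup E] [NormedAddCommGroup G]

/-- Lipschitz continuity on bounded sets. -/
def LipschitzOnBounded (F : E → G) : Prop :=
  ∀ R : ℝ, ∃ K, LipschitzOnWith K F (Metric.closedBall 0 R)

namespace LipschitzOnBounded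

theorem id : LipschitzOnBounded (fun v : E ↦ v) := fun _ ↦ ⟨1, LipschitzWith.id.lipschitzOnWith⟩

variable {f g : E → G}

theorem add (hf : LipschitzOnBounded f) (hg : LipschitzOnBounded g) :
    LipschitzOnBounded fun v ↦ f v + g v := fun R ↦
  let ⟨_, hK⟩ := hf R
  let ⟨_, hK'⟩ := hg R
  ⟨_, hK.add hK'⟩

theorem sub (hf : LipschitzOnBounded f) (hg : LipschitzOnBounded g) :
    LipschitzOnBounded fun v ↦ f v - g v := fun R ↦
  let ⟨_, hK⟩ := hf R
  let ⟨_, hK'⟩ := hg R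
  ⟨_, hK.sub hK'⟩

theorem exists_norm_le (hf : LipschitzOnBounded f) (R : ℝ) :
    ∃ M : NNReal, ∀ v ∈ Metric.closedBall (0 : E) R, ‖f v‖ ≤ M := by
  obtain ⟨K, hK⟩ := hf R
  refine ⟨‖f 0‖₊ + K * R.toNNReal, fun v hv ↦ ?_⟩
  have hv' : ‖v‖ ≤ R := by simpa using hv
  have hR : 0 ≤ R := (norm_nonneg v).trans hv'
  have h := hK.norm_sub_le hv (Metric.mem_closedBall_self hR)
  rw [sub_zero] at h
  have h1 := norm_le_norm_sub_add (f v) (f 0)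
  have h2 : (K : ℝ) * ‖v‖ ≤ K * R := by gcongr
  push_cast
  rw [Real.coe_toNNReal R hR]
  linarith

variable [NormedSpace ℝ G]

theorem clm_comp (L : G →L[ℝ] G) (hf : LipschitzOnBounded f) :
    LipschitzOnBounded fun v ↦ L (f v) := fun R ↦
  let ⟨_, hK⟩ := hf R
  ⟨_, L.lipschitz.comp_lipschitzOnWith hK⟩

theorem const_smul (c : ℝ) (hf : LipschitzOnBounded f) : LipschitzOnBounded fun v ↦ c • f v :=
  hf.clm_comp (c • ContinuousLinearMap.id ℝ G)

theorem bilin (B : G →L[ℝ] G →L[ℝ] G) (hf : LipschitzOnBounded f) (hg : LipschitzOnBounded g) :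
    LipschitzOnBounded fun v ↦ B (f v) (g v) := fun R ↦ by
  obtain ⟨K, hK⟩ := hf R
  obtain ⟨K', hK'⟩ := hg R
  obtain ⟨M, hM⟩ := hf.exists_norm_le R
  obtain ⟨M', hM'⟩ := hg.exists_norm_le R
  refine ⟨‖B‖₊ * (K * M' + M * K'), LipschitzOnWith.of_dist_le_mul fun v hv w hw ↦ ?_⟩
  rw [dist_eq_norm, dist_eq_norm]
  have e : B (f v) (g v) - B (f w) (g w) = B (f v - f w) (g v) + B (f w) (g v - g w) := by
    simp only [map_sub, sub_apply]
    abel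
  calc ‖B (f v) (g v) - B (f w) (g w)‖
      ≤ ‖B‖ * ‖f v - f w‖ * ‖g v‖ + ‖B‖ * ‖f w‖ * ‖g v - g w‖ := by
        rw [e]
        exact (norm_add_le _ _).trans (add_le_add (B.le_opNorm₂ _ _) (B.le_opNorm₂ _ _))
    _ ≤ ‖B‖ * (K * ‖v - w‖) * M' + ‖B‖ * M * (K' * ‖v - w‖) := by
        gcongr
        · exact hK.norm_sub_le hv hw
        · exact hM' v hv
        · exact hM w hw
        · exact hK'.norm_sub_le hv hw
    _ = _ := by push_cast; ring

end LipschitzOnBounded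
end LipschitzOnBounded

/-! ### Multiplication on `H^s ∩ L^∞` -/

namespace HsLinf

variable {s : ℝ} {α : ℝ → ℝ}

theorem norm_le_of_enorm_le {u : HsLinf s} {C : ℝ≥0∞} {r : ℝ} (hr : 0 ≤ r) (hC : C ≠ ∞)
    (h : ‖u‖ₑ ≤ C * ENNReal.ofReal r) : ‖u‖ ≤ C.toReal * r := by
  rw [← toReal_enorm, ← ENNReal.toReal_ofReal hr, ← ENNReal.toReal_mul]
  exact ENNReal.toReal_mono (ENNReal.mul_ne_top hC ENNReal.ofReal_ne_top) h

/-- Pointwise multiplication on `H^s ∩ L^∞`. -/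
theorem exists_mul (hs : 0 < s) : ∃ C : ℝ, ∀ u v : HsLinf s, ∃ w : HsLinf s,
    (⇑w =ᵐ[volume] fun x ↦ u x * v x) ∧ ‖w‖ ≤ C * ‖u‖ * ‖v‖ := by
  obtain ⟨D, hD, h⟩ := exists_eLpNorm_weightedFourier_mul_le hs
  -- `D` bounds the Sobolev part of the product and 1 its supremum part.
  refine ⟨(D + 1).toReal, fun u v ↦ ?_⟩
  have hp2 : MemLp (fun x ↦ u x * v x) 2 := (Lp.memLp v.toL2).mul (memLp_top u)
  have hpt : MemLp (fun x ↦ u x * v x) ∞ := (memLp_top v).mul (memLp_top u)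
  have hw := hp2.coeFn_toLp
  have h1 := h (memLp_weightedFourier u).2.ne (memLp_weightedFourier v).2.ne hw
  rw [← enorm_eq, ← enorm_eq] at h1
  have hfin : D * (‖u‖ₑ * ‖v‖ₑ) < ∞ :=
    ENNReal.mul_lt_top hD.lt_top (ENNReal.mul_lt_top enorm_lt_top enorm_lt_top)
  refine ⟨mk (hp2.toLp _) ⟨aestronglyMeasurable_weightedFourier _ s, h1.trans_lt hfin⟩
    ((memLp_congr_ae hw).2 hpt), hw, ?_⟩
  rw [mul_assoc]
  refine norm_le_of_enorm_le (by positivity) (ENNReal.add_ne_top.2 ⟨hD, ENNReal.one_ne_top⟩) ?_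
  rw [enorm_eq, add_mul, one_mul, ENNReal.ofReal_mul (norm_nonneg u), ofReal_norm, ofReal_norm]
  refine add_le_add h1 ?_
  refine (eLpNorm_congr_ae hw).trans_le ?_
  exact (eLpNorm_smul_le_mul_eLpNorm (p := ∞) (q := ∞) (r := ∞) (memLp_top v).1
    (memLp_top u).1).trans (mul_le_mul' (eLpNorm_top_le u) (eLpNorm_top_le v))

/-- Pointwise multiplication as a continuous bilinear map. -/
theorem exists_mulL (hs : 0 < s) : ∃ B : HsLinf s →L[ℝ] HsLinf s →L[ℝ] HsLinf s,
    ∀ u v, ⇑(B u v) =ᵐ[volume] fun x ↦ u x * v x := by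
  obtain ⟨C, hC⟩ := exists_mul hs
  choose m hm hmC using hC
  refine ⟨LinearMap.mkContinuous₂ (LinearMap.mk₂ ℝ m (fun u u' v ↦ ext_ae ?_)
    (fun c u v ↦ ext_ae ?_) (fun u v v' ↦ ext_ae ?_) (fun c u v ↦ ext_ae ?_)) C hmC, hm⟩
  · filter_upwards [hm (u + u') v, hm u v, hm u' v, coeFn_add u u', coeFn_add (m u v) (m u' v)]
      with x a b c d e
    rw [a, e, b, c, d, add_mul]
  · filter_upwards [hm (c • u) v, hm u v, coeFn_smul c u, coeFn_smul c (m u v)] with x a b d e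
    rw [a, e, b, d, mul_assoc]
  · filter_upwards [hm u (v + v'), hm u v, hm u v', coeFn_add v v', coeFn_add (m u v) (m u v')]
      with x a b c d e
    rw [a, e, b, c, d, mul_add]
  · filter_upwards [hm u (c • v), hm u v, coeFn_smul c v, coeFn_smul c (m u v)] with x a b d e
    rw [a, e, b, d, mul_left_comm]

end HsLinf

/-! ### Convolution with an integrable kernel -/

section Conv

variable {s : ℝ} {α : ℝ → ℝ}

/-- Since `α` need not be even, `conv` is the usual convolution with the reflected kernel. -/
theorem conv_eq (α v : ℝ → ℝ) (x : ℝ) : conv α v x = ∫ t, α (-t) * v (x - t) := by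
  rw [conv, ← integral_sub_left_eq_self _ volume x]
  simp

theorem conv_congr {v w : ℝ → ℝ} (h : v =ᵐ[volume] w) (x : ℝ) : conv α v x = conv α w x := by
  refine integral_congr_ae ?_
  filter_upwards [h] with y hy
  rw [hy]

theorem integrable_mul_of_memLp_top (hα : Integrable α) {v : ℝ → ℝ} (hv : MemLp v ∞ volume)
    (x : ℝ) : Integrable fun y ↦ α (y - x) * v y :=
  (hα.comp_sub_right x).mul_of_top_left hv

theorem enorm_conv_le {v : ℝ → ℝ} (hv : MemLp v ∞ volume) (x : ℝ) :
    ‖conv α v x‖ₑ ≤ eLpNorm α 1 volume * eLpNorm v ∞ volume := by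
  refine (enorm_integral_le_lintegral_enorm _).trans ?_
  calc ∫⁻ y, ‖α (y - x) * v y‖ₑ ≤ ∫⁻ y, ‖α (y - x)‖ₑ * eLpNorm v ∞ volume := by
        refine lintegral_mono_ae ?_
        filter_upwards [ae_enorm_le_eLpNorm_top v] with y hy
        rw [enorm_mul]
        exact mul_le_mul_right hy _
    _ = _ := by
        rw [lintegral_mul_const' _ _ hv.2.ne, lintegral_sub_right_eq_self (fun y ↦ ‖α y‖ₑ) x,
          eLpNorm_one_eq_lintegral_enorm]

/-- The Fourier transform of `α ∗ v` is dominated by that of `v`. -/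
theorem enorm_fourierL2_conv_le (hα : Integrable α) {v w : Lp ℝ 2 (volume : Measure ℝ)}
    (hw : ⇑w =ᵐ[volume] conv α v) :
    ∀ᵐ ξ, ‖fourierL2 w ξ‖ₑ ≤ eLpNorm α 1 volume * ‖fourierL2 v ξ‖ₑ := by
  have hc : Integrable fun t ↦ ((α (-t) : ℝ) : ℂ) := hα.comp_neg.ofReal
  have hW : complexify w = (memLp_conv hc (Lp.memLp (complexify v))).toLp _ := by
    refine Lp.ext ?_
    filter_upwards [coeFn_complexify w, hw,
      (memLp_conv hc (Lp.memLp (complexify v))).coeFn_toLp] with x a b c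
    rw [a, b, c, conv_congr_ae (coeFn_complexify v), conv_eq, ← integral_complex_ofReal]
    simp only [Complex.ofReal_mul]
  have h := l2Fourier_conv hc (complexify v)
  rw [← hW] at h
  filter_upwards [h] with ξ hξ
  rw [fourierL2_apply, hξ, enorm_mul]
  refine mul_le_mul_left ?_ _
  rw [eLpNorm_one_eq_lintegral_enorm, ← lintegral_neg_eq_self]
  refine (enorm_integral_le_lintegral_enorm _).trans_eq (lintegral_congr fun t ↦ ?_)
  rw [enorm_eq_iff_norm_eq, Circle.norm_smul, Complex.norm_real]

end Conv

/-! ### The convolution operator and the cubic force on `H^s ∩ L^∞` -/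

namespace HsLinf

variable {s : ℝ} {α : ℝ → ℝ}

/-- Convolution with `α ∈ L¹` on `H^s ∩ L^∞`. -/
theorem exists_conv (hα : Integrable α) (v : HsLinf s) : ∃ w : HsLinf s,
    ⇑w =ᵐ[volume] conv α v ∧ ‖w‖ ≤ (eLpNorm α 1 volume).toReal * ‖v‖ := by
  have hA : eLpNorm α 1 volume ≠ ∞ := (memLp_one_iff_integrable.2 hα).2.ne
  have hp : MemLp (conv α v) 2 := by
    have := memLp_conv hα.comp_neg (Lp.memLp v.toL2)
    exact (memLp_congr_ae (ae_of_all _ fun x ↦ (conv_eq α v x))).2 this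
  have hw := hp.coeFn_toLp
  have h1 : eLpNorm (weightedFourier s (hp.toLp _)) 2 volume ≤
      eLpNorm α 1 volume * eLpNorm (weightedFourier s v.toL2) 2 volume := by
    rw [← ENNReal.pow_le_pow_left_iff two_ne_zero, mul_pow, eLpNorm_two_sq, eLpNorm_two_sq,
      ← lintegral_const_mul' _ _ (ENNReal.pow_ne_top hA)]
    refine lintegral_mono_ae ?_
    filter_upwards [enorm_fourierL2_conv_le hα hw] with ξ hξ
    rw [← mul_pow, enorm_weightedFourier, enorm_weightedFourier, mul_left_comm]
    exact pow_le_pow_left₀ zero_le (mul_le_mul_right hξ _) 2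
  have h2 : eLpNorm (hp.toLp _) ∞ volume ≤
      eLpNorm α 1 volume * eLpNorm (v : ℝ → ℝ) ∞ volume := by
    rw [eLpNorm_congr_ae hw, eLpNorm_exponent_top]
    exact eLpNormEssSup_le_of_ae_enorm_bound (ae_of_all _ (enorm_conv_le (memLp_top v)))
  refine ⟨mk (hp.toLp _) ⟨aestronglyMeasurable_weightedFourier _ s, h1.trans_lt
    (ENNReal.mul_lt_top hA.lt_top (memLp_weightedFourier v).2)⟩ ⟨(Lp.memLp _).1, h2.trans_lt
    (ENNReal.mul_lt_top hA.lt_top (memLp_top v).2)⟩, hw, ?_⟩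
  refine norm_le_of_enorm_le (norm_nonneg v) hA ?_
  rw [ofReal_norm, enorm_eq, enorm_eq, mul_add]
  exact add_le_add h1 h2

/-- Convolution with `α ∈ L¹` as a continuous linear map. -/
theorem exists_convL (hα : Integrable α) : ∃ C : HsLinf s →L[ℝ] HsLinf s,
    ∀ v, ⇑(C v) =ᵐ[volume] conv α v := by
  choose c hc hcC using exists_conv (s := s) hα
  refine ⟨LinearMap.mkContinuous
    { toFun := c, map_add' := fun u v ↦ ext_ae ?_, map_smul' := fun r u ↦ ext_ae ?_ } _ hcC, hc⟩
  · filter_upwards [hc (u + v), hc u, hc v, coeFn_add (c u) (c v)] with x h1 h2 h3 h4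
    rw [h1, h4, h2, h3, conv_congr (coeFn_add u v), conv, conv, conv,
      ← integral_add (integrable_mul_of_memLp_top hα (memLp_top u) x)
        (integrable_mul_of_memLp_top hα (memLp_top v) x)]
    simp only [mul_add]
  · filter_upwards [hc (r • u), hc u, coeFn_smul r (c u)] with x h1 h2 h3
    rw [h1, RingHom.id_apply, h3, h2, conv_congr (coeFn_smul r u), conv, conv,
      ← integral_const_mul]
    simp only [mul_left_comm]

theorem integrable_conv_pow (hα : Integrable α) (v : HsLinf s) (n : ℕ) (x : ℝ) :
    Integrable fun y ↦ α (y - x) * v y ^ n := by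
  refine integrable_mul_of_memLp_top hα (memLp_top_of_bound ((memLp_top v).1.pow n)
    ((eLpNorm (v : ℝ → ℝ) ∞ volume).toReal ^ n) ?_) x
  filter_upwards [ae_enorm_le_eLpNorm_top (v : ℝ → ℝ)] with y hy
  rw [Pi.pow_apply, norm_pow, ← toReal_enorm]
  exact pow_le_pow_left₀ ENNReal.toReal_nonneg (ENNReal.toReal_mono (memLp_top v).2.ne hy) n

/-- For `w(η) = η³` the peridynamic integral is the cubic force. -/
theorem integral_cube_eq_cubicForce (hα : Integrable α) (v : HsLinf s) (x : ℝ) :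
    Integrable (fun y ↦ α (y - x) * (v y - v x) ^ 3) ∧
      ∫ y, α (y - x) * (v y - v x) ^ 3 = cubicForce α v x := by
  have h3 := integrable_conv_pow hα v 3 x
  have h2 := (integrable_conv_pow hα v 2 x).const_mul (3 * v x)
  have h1 := (integrable_conv_pow hα v 1 x).const_mul (3 * v x ^ 2)
  have h0 := (hα.comp_sub_right x).mul_const (v x ^ 3)
  have e : (fun y ↦ α (y - x) * (v y - v x) ^ 3) = fun y ↦ α (y - x) * v y ^ 3 -
      3 * v x * (α (y - x) * v y ^ 2) + 3 * v x ^ 2 * (α (y - x) * v y ^ 1) -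
        α (y - x) * v x ^ 3 := by
    funext y
    ring
  rw [e]
  have h32 : Integrable fun y ↦ α (y - x) * v y ^ 3 - 3 * v x * (α (y - x) * v y ^ 2) := h3.sub h2
  have h321 : Integrable fun y ↦ α (y - x) * v y ^ 3 - 3 * v x * (α (y - x) * v y ^ 2) +
    3 * v x ^ 2 * (α (y - x) * v y ^ 1) := h32.add h1
  refine ⟨h321.sub h0, ?_⟩
  rw [integral_sub h321 h0, integral_add h32 h1, integral_sub h3 h2,
    integral_const_mul, integral_const_mul, integral_mul_const,
    integral_sub_right_eq_self (fun y ↦ α y) x]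
  simp only [pow_one]
  rfl

/-- The cubic force as a map of `H^s ∩ L^∞`, Lipschitz on bounded sets. -/
theorem exists_cubicForce (hα : Integrable α) (hs : 0 < s) : ∃ F : HsLinf s → HsLinf s,
    (∀ v, ⇑(F v) =ᵐ[volume] cubicForce α v) ∧ LipschitzOnBounded F := by
  obtain ⟨B, hB⟩ := exists_mulL hs
  obtain ⟨C, hC⟩ := exists_convL (s := s) hα
  refine ⟨fun v ↦ C (B v (B v v)) - (3 : ℝ) • B v (C (B v v)) + (3 : ℝ) • B (B v v) (C v) -
    (∫ y, α y) • B v (B v v), fun v ↦ ?_, ?_⟩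
  · have hsq : ⇑(B v v) =ᵐ[volume] fun y ↦ v y ^ 2 := by
      filter_upwards [hB v v] with y hy
      rw [hy, sq]
    have hcu : ⇑(B v (B v v)) =ᵐ[volume] fun y ↦ v y ^ 3 := by
      filter_upwards [hB v (B v v), hsq] with y a b
      rw [a, b]
      ring
    filter_upwards [hsq, hcu, hC v, hC (B v v), hC (B v (B v v)), hB v (C (B v v)),
      hB (B v v) (C v), coeFn_smul 3 (B v (C (B v v))), coeFn_smul 3 (B (B v v) (C v)),
      coeFn_smul (∫ y, α y) (B v (B v v)),
      coeFn_sub (C (B v (B v v))) ((3 : ℝ) • B v (C (B v v))),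
      coeFn_add (C (B v (B v v)) - (3 : ℝ) • B v (C (B v v))) ((3 : ℝ) • B (B v v) (C v)),
      coeFn_sub (C (B v (B v v)) - (3 : ℝ) • B v (C (B v v)) + (3 : ℝ) • B (B v v) (C v))
        ((∫ y, α y) • B v (B v v))] with x a1 a2 a3 a4 a5 a6 a7 a8 a9 a10 a11 a12 a13
    rw [a13, a12, a11, a10, a9, a8, a7, a6, a5, a4, a3, a2, a1, conv_congr hcu, conv_congr hsq,
      cubicForce]
    ring
  · have h1 : LipschitzOnBounded fun v : HsLinf s ↦ v := .id
    have h2 := h1.bilin B h1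
    have h3 := h1.bilin B h2
    exact (((h3.clm_comp C).sub ((h1.bilin B (h2.clm_comp C)).const_smul 3)).add
      ((h2.bilin B (h1.clm_comp C)).const_smul 3)).sub (h3.const_smul _)

end HsLinf

/-- Elements of the space that agree almost everywhere are equal, so the equation for almost every
`x` is the equation `u'' = F u` in the space, to which the abstract theory applies. -/
theorem isSolution_iff {s : ℝ} {α : ℝ → ℝ} {F : HsLinf s → HsLinf s}
    (hF : ∀ v, ⇑(F v) =ᵐ[volume] cubicForce α v) {T : ℝ} {φ ψ : HsLinf s} {u : ℝ → HsLinf s} :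
    IsSolution α T φ ψ u ↔ SolvesSecondOrder F T φ ψ u :=
  ⟨fun h ↦ ⟨h.contDiffOn, fun t ht ↦ HsLinf.ext_ae ((h.equation t ht).trans (hF _).symm),
    h.initial_value, h.initial_velocity⟩,
   fun h ↦ ⟨h.contDiffOn, fun t ht ↦ by rw [h.equation t ht]; exact hF _,
    h.initial_value, h.initial_velocity⟩⟩

end Peridynamic

theorem theorem3p1 (α : ℝ → ℝ) (hα : MeasureTheory.Integrable α) (s : ℝ) (hs : 0 < s) :
    -- for `w(η) = η³` the peridynamic integral is the right-hand side of the cubic equation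
    (∀ v : Peridynamic.HsLinf s, ∀ᵐ x : ℝ,
      MeasureTheory.Integrable (fun y ↦ α (y - x) * (v y - v x) ^ 3) ∧
      ∫ y, α (y - x) * (v y - v x) ^ 3 = Peridynamic.cubicForce α v x) ∧
    -- local well-posedness: existence, uniqueness, continuous dependence on the data
    (∀ φ ψ : Peridynamic.HsLinf s, ∃ T : ℝ, 0 < T ∧
      (∃ u : ℝ → Peridynamic.HsLinf s, Peridynamic.IsSolution α T φ ψ u ∧
        ∀ v : ℝ → Peridynamic.HsLinf s, Peridynamic.IsSolution α T φ ψ v →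
          Set.EqOn v u (Set.Icc 0 T)) ∧
      ∃ δ : ℝ, 0 < δ ∧
        (∀ φ₁ ψ₁ : Peridynamic.HsLinf s, ‖φ₁ - φ‖ < δ → ‖ψ₁ - ψ‖ < δ →
          ∃ u₁ : ℝ → Peridynamic.HsLinf s, Peridynamic.IsSolution α T φ₁ ψ₁ u₁) ∧
        ∀ φ₁ ψ₁ φ₂ ψ₂ : Peridynamic.HsLinf s,
          ‖φ₁ - φ‖ < δ → ‖ψ₁ - ψ‖ < δ → ‖φ₂ - φ‖ < δ → ‖ψ₂ - ψ‖ < δ →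
          ∀ u₁ u₂ : ℝ → Peridynamic.HsLinf s,
            Peridynamic.IsSolution α T φ₁ ψ₁ u₁ → Peridynamic.IsSolution α T φ₂ ψ₂ u₂ →
            ∀ t ∈ Set.Icc 0 T,
              ‖u₁ t - u₂ t‖ ≤ 2 * ‖φ₁ - φ₂‖ + 2 * t * ‖ψ₁ - ψ₂‖) := by
  refine ⟨fun v ↦ Filter.Eventually.of_forall
    fun x ↦ Peridynamic.HsLinf.integral_cube_eq_cubicForce hα v x, fun φ ψ ↦ ?_⟩
  obtain ⟨F, hF, hL⟩ := Peridynamic.HsLinf.exists_cubicForce hα hs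
  have := Peridynamic.HsLinf.completeSpace hs.le
  simp only [Peridynamic.isSolution_iff hF]
  exact Peridynamic.wellPosed_secondOrder hL φ ψ
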